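/- **Setting.** Let $X=(x_i)_{i=1}^m$ and $Y=(y_j)_{j=1}^n$ be points in $\mathbb R^d$ ($d\ge 1$), let $\kappa:\mathbb R^d\times\mathbb R^d\to\mathbb R$ be any kernel function, and let $K_{XY}=[\kappa(x_i,y_j)]$ be the kernel matrix. Let $1\le r\le n$. The *one-sided compression algorithm* (1) selects $r$ of the $n$ points of $Y$ (pairwise distinct indices) by a geometric selection algorithm, which gives $S_2\subseteq Y$; (2) forms the $m\times r$ matrix $K_{XS_2}$ and computes an *interpolative decomposition* (ID) of it, that is, $K_{XS_2}=U K_{\mathcal I S_2}$ with $U=P\begin{bmatrix} I\\ G\end{bmatrix}$, where $P$ is a permutation matrix, $\mathcal I\subseteq X$ consists of $\operatorname{rank}K_{XS_2}$ points (the points belonging to the first rows of $P^TK_{XS_2}$) and $|G_{ij}|\le 2$ for all $i,j$; (3) returns $U$ and $K_{\mathcal I Y}$, as the approximation $K_{XY}\approx UK_{\mathcal IY}$. **Operation count.** Subroutines are algebraic computation trees over the reals, one for each problem size. Each arithmetic operation $+,-,\times,\div,\sqrt{\ }$ and each comparison that is executed counts as one operation; rational constants and the bookkeeping of indices are free. A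 kernel evaluation is charged $t\le a\,d$ operations, for a constant $a$. The count of the algorithm is the sum of the operations of the selection, the $mr$ kernel evaluations for $K_{XS_2}$, the operations of the ID, the $m|\mathcal I|$ entries of $U$, and the $|\mathcal I|n$ kernel evaluations for $K_{\mathcal IY}$. **Theorem.** 1. There is an absolute constant $c$ such that farthest point sampling, uniform random sampling, and every mixed scheme (farthest point sampling for the first $p$ points, random sampling for the others) select $r$ of $n$ points of $\mathbb R^d$ in at most $c\,dr^2n$ operations, for every outcome of the random choices (which are given by an ordering of the $n$ points; drawing it is not counted). 2. There is an algorithm that computes an ID of every real matrix, such that for all constants $c_0,a$ there is a constant $C$, depending on $c_0$ and $a$ only, with the following property. For all $d,m,n,r,t,X,Y,\kappa$ as above and every selection algorithm that always selects $r$ of $n$ points of $\mathbb R^d$ in at most $c_0\,dr^2n$ operations, the one-sided compression algorithm with this selection and this ID computes $S_2$, $\mathcal I$, $U$ and $K_{\mathcal IY}$ with $K_{XS_2}=UK_{\mathcal IS_2}$ as in (2), the approximation satisfies $\operatorname{rank}(UK_{\mathcal IY})=|\mathcal I|=\operatorname{rank}K_{XS_2}\le r$ (so its rank is exactly $r$ if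 $K_{XS_2}$ has rank $r$), and the number of operations is at most $C\,dr^2(m+n)$. -/

import Mathlib

/-! Real-number programs with an operation count, interpolative decompositions, and the data-driven
one-sided compression of a kernel matrix. -/

namespace OneSided

/-- The unit-cost operations of exact real arithmetic. `sqrt` ignores its second argument. -/
inductive ArithOp
  | add | sub | mul | div | sqrt

/-- The value of an operation. -/
noncomputable def ArithOp.apply : ArithOp → ℝ → ℝ → ℝ
  | .add, a, b => a + b
  | .sub, a, b => a - b
  | .mul, a, b => a * b
  | .div, a, b => a / b
  | .sqrt, a, _ => Real.sqrt a

/-- What an instruction may refer to: an input number, the result of the `k`-th arithmetic operation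
executed so far, or a rational constant. -/
inductive Operand (ι : Type)
  | input (i : ι)
  | reg (k : ℕ)
  | const (q : ℚ)

/-- The number an operand stands for, when the inputs are `inp` and the results of the operations
executed so far are listed in `mem`. -/
noncomputable def Operand.val {ι : Type} (inp : ι → ℝ) (mem : List ℝ) : Operand ι → ℝ
  | .input i => inp i
  | .reg k => mem.getD k 0
  | .const q => (q : ℝ)

/-- Algebraic computation trees with real inputs indexed by `ι` and output in the discrete type `α`.
Real numbers influence the control flow only through the comparisons `le`; real outputs are given by
operands. -/
inductive Prog (ι : Type) (α : Type)
  | ret (a : α)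
  | op (o : ArithOp) (u v : Operand ι) (next : Prog ι α)
  | le (u v : Operand ι) (yes no : Prog ι α)

open Classical in
/-- Execution from memory `mem`: the output, and the memory at the end. -/
noncomputable def Prog.exec {ι α : Type} (inp : ι → ℝ) : Prog ι α → List ℝ → α × List ℝ
  | .ret a, mem => (a, mem)
  | .op o u v next, mem => next.exec inp (mem ++ [o.apply (u.val inp mem) (v.val inp mem)])
  | .le u v yes no, mem =>
      if u.val inp mem ≤ v.val inp mem then yes.exec inp mem else no.exec inp mem

open Classical in
/-- The number of operations (arithmetic operations and comparisons) executed from memory `mem`. -/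
noncomputable def Prog.cost {ι α : Type} (inp : ι → ℝ) : Prog ι α → List ℝ → ℕ
  | .ret _, _ => 0
  | .op o u v next, mem =>
      1 + next.cost inp (mem ++ [o.apply (u.val inp mem) (v.val inp mem)])
  | .le u v yes no, mem =>
      1 + if u.val inp mem ≤ v.val inp mem then yes.cost inp mem else no.cost inp mem

/-- Points of `ℝ^d` with the Euclidean distance. -/
abbrev Pt (d : ℕ) : Type := EuclideanSpace ℝ (Fin d)

/-- The kernel matrix `[κ(x_i, y_j)]`. -/
def kernelMatrix {d m n : ℕ} (κ : Pt d → Pt d → ℝ) (X : Fin m → Pt d) (Y : Fin n → Pt d) :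
    Matrix (Fin m) (Fin n) ℝ :=
  Matrix.of fun i j => κ (X i) (Y j)

/-! ### Interpolative decompositions -/

/-- The data `P, G` of a matrix `U = P [I; G]` with `m` rows and `k` columns. The permutation matrix
`P` is given by a bijection `σ`: row `i` of `[I; G]` becomes row `σ i` of `U`. The entries of `G`
lie in `R` (numbers, or operands of a program). -/
structure IDData (m : ℕ) (R : Type) where
  k : ℕ
  l : ℕ
  σ : Fin k ⊕ Fin l ≃ Fin m
  G : Matrix (Fin l) (Fin k) R

/-- Indices of the selected rows, those that `P` moves from the top. -/
def IDData.rows {m : ℕ} {R : Type} (D : IDData m R) : Fin D.k → Fin m :=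
  fun a => D.σ (Sum.inl a)

/-- The permutation matrix `P`. -/
def IDData.P {m : ℕ} {R : Type} (D : IDData m R) : Matrix (Fin m) (Fin D.k ⊕ Fin D.l) ℝ :=
  D.σ.symm.toPEquiv.toMatrix

/-- `U = P [I; G]`. -/
def IDData.U {m : ℕ} (D : IDData m ℝ) : Matrix (Fin m) (Fin D.k) ℝ :=
  D.P * Matrix.fromRows (1 : Matrix (Fin D.k) (Fin D.k) ℝ) D.G

/-- `D` is an interpolative decomposition of `M`: `M = U M₁` with `U = P [I; G]`, where `M₁`
consists of `rank M` rows of `M` (the first rows of `Pᵀ M`), and the entries of `G` are at most `2`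
in absolute value. -/
structure IsID {m r : ℕ} (M : Matrix (Fin m) (Fin r) ℝ) (D : IDData m ℝ) : Prop where
  card_rows : D.k = M.rank
  factor : M = D.U * M.submatrix D.rows id
  bound : ∀ b a, |D.G b a| ≤ 2

/-- Programs that read an `m × r` matrix and return the data `P, G`. -/
abbrev IDProg (m r : ℕ) : Type := Prog (Fin m × Fin r) (IDData m (Operand (Fin m × Fin r)))

/-- The decomposition data that the program returns on the matrix `M`. -/
noncomputable def IDProg.result {m r : ℕ} (p : IDProg m r) (M : Matrix (Fin m) (Fin r) ℝ) :
    IDData m ℝ :=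
  let inp : Fin m × Fin r → ℝ := fun e => M e.1 e.2
  let out := p.exec inp []
  { k := out.1.k
    l := out.1.l
    σ := out.1.σ
    G := out.1.G.map (Operand.val inp out.2) }

/-- The number of operations that the program executes on the matrix `M`. -/
noncomputable def IDProg.ops {m r : ℕ} (p : IDProg m r) (M : Matrix (Fin m) (Fin r) ℝ) : ℕ :=
  p.cost (fun e => M e.1 e.2) []

/-! ### Geometric selection -/

/-- Programs that read the coordinates of `n` points of `ℝ^d` and select `r` of the points. -/
abbrev SelProg (d n r : ℕ) : Type := Prog (Fin n × Fin d) (Fin r ↪ Fin n)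

/-- The selected (indices of) points. -/
noncomputable def SelProg.result {d n r : ℕ} (p : SelProg d n r) (Y : Fin n → Pt d) :
    Fin r ↪ Fin n :=
  (p.exec (fun e => Y e.1 e.2) []).1

/-- The number of operations that the program executes on the points `Y`. -/
noncomputable def SelProg.ops {d n r : ℕ} (p : SelProg d n r) (Y : Fin n → Pt d) : ℕ :=
  p.cost (fun e => Y e.1 e.2) []

/-- `s` is the sample obtained from `Y` by farthest point sampling for the first `p` points and by
random sampling for the others, where the random choices are read off from an ordering `π` of the
points: the initial point and the points number `p, p + 1, …` (counted from `0`) are the first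
points in this ordering that have not been selected before. With `π` uniformly distributed this is
uniform random sampling for `p = 0`, farthest point sampling for `p = r`, and a mixed scheme in
between. -/
structure IsSample {d n r : ℕ} (Y : Fin n → Pt d) (p : ℕ) (π : Equiv.Perm (Fin n))
    (s : Fin r ↪ Fin n) : Prop where
  random : ∀ k : Fin r, ((k : ℕ) = 0 ∨ p ≤ (k : ℕ)) →
    ∀ j : Fin n, (∀ i, i < k → s i ≠ j) → π.symm (s k) ≤ π.symm j
  farthest : ∀ k : Fin r, 0 < (k : ℕ) → (k : ℕ) < p →
    ∀ j : Fin n, (∀ i, i < k → s i ≠ j) →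
      Metric.infDist (Y j) ((fun i => Y (s i)) '' {i | i < k}) ≤
        Metric.infDist (Y (s k)) ((fun i => Y (s i)) '' {i | i < k})

/-! ### The compression algorithm -/

/-- The outcome of a run of the compression algorithm: the sample `S₂`, the data of `U`, the matrix
`K_{IY}`, and the number of operations. -/
structure Run (m n r : ℕ) where
  S : Fin r ↪ Fin n
  D : IDData m ℝ
  KIY : Matrix (Fin D.k) (Fin n) ℝ
  ops : ℕ

/-- Data-driven one-sided compression of `K_{XY}`: select `r` points `S₂` of `Y`, form `K_{X S₂}`,
compute its interpolative decomposition, and return `U` and `K_{IY}`, where `I` is the set of points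
of `X` that belong to the selected rows. A kernel evaluation is charged `t` operations. The count
consists of the selection, the `m r` kernel evaluations for `K_{X S₂}`, the interpolative
decomposition, writing down `U`, and the kernel evaluations for `K_{IY}`. -/
noncomputable def compress {d m n r : ℕ} (sel : SelProg d n r) (idp : IDProg m r) (t : ℕ)
    (κ : Pt d → Pt d → ℝ) (X : Fin m → Pt d) (Y : Fin n → Pt d) : Run m n r :=
  let S := sel.result Y
  let M := kernelMatrix κ X (fun a => Y (S a))
  let D := idp.result M
  { S := S
    D := D
    KIY := kernelMatrix κ (fun a => X (D.rows a)) Y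
    ops := sel.ops Y + t * (m * r) + idp.ops M + m * D.k + t * (D.k * n) }

end OneSided

/-!
The selection part is direct: recomputing all squared distances to the points selected so far costs
`O(d r n)` per point. The counting of the compression algorithm is routine once an `m × r` matrix `M`
has an interpolative decomposition with entries at most `2` that takes `O(m r²)` operations, without
a logarithmic factor and whatever the matrix is. This is the core of the proof.

Gauss–Jordan elimination by column operations gives `M = V M_I`, where `V` is `m × k` with
`k = rank M` and contains the unit rows, `V_I = 1` (`IsReduction.isColumnBasis`). If `V = F V_J` for
another set `J` of `k` rows, then `M = F M_J`. By Cramer's rule, an entry of `F` is the factor by which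
an exchange of a row of `J` changes `det V_J` (`isInterpolation_pivot`). Hence, exchanging rows as
long as an entry exceeds `2`, the determinant at least doubles each time. One exchange costs
`O(m k)`, so only `O(k)` of them can be afforded: `J` has to start with `det V_J` within a factor
`exp (O(k))` of the maximum (`runs_exchange`).

Such a `J` is found by means of an approximate D-optimal design (a John ellipsoid): weights `w ≥ 0`
of total at most `9 k` such that, with `H` the inverse of the moment matrix `A = ∑ wᵢ vᵢ vᵢᵀ`, every
row has leverage `vᵢᵀ H vᵢ ≤ 1`. Then `(det V_J)² ≤ det A` for all `J`, by the inequality of the means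
(`IsDesign.det_sq_le`). Conversely, the leverages have the weighted sum `k`, so that the largest is
at least `k / 9k`; deflating `H` by that row leaves a weighted sum `k - 1`, and so on. The greedily
selected rows `S` therefore satisfy `(det V_S)² det H ≥ k! / (9k)^k` (`runs_greedy`), that is,
`det A ≤ (9e)^k (det V_S)² ≤ 4^(3k) (det V_S)²`, and `3 k` exchanges suffice.

To find the design (`runs_coverCode`), one starts with the weights `(k / 2m) (1 + 1_I)`, for which all
leverages are at most `2m / k`, and adds one to the weight of a row of leverage larger than one: this
at least doubles `det A` and costs `O(k²)` by the Sherman–Morrison formula. If the leverages are at most `L`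
at first, then `det A` grows at most by the factor `(1 + q L)^k` in `k q` additions, again by the
inequality of the means; so fewer than `k q` additions are possible if `1 + q L < 2^q`
(`IsDesign.not_two_pow_le`). Searching for these rows one by one would be too expensive. Instead, the
moment matrices of all initial segments of the rows are stored, which gives the sum of the leverages
over any block of consecutive rows in `O(k²)` operations. At level `j`, the blocks of `2^j` rows are
visited, and only a block whose leverages add up to more than `2^j` is searched (`runs_sweep`). After
level `j` all leverages are at most `2^j`; scaling the weights back to total `k` multiplies them by
`2j + 9`, so that `q = O(j)` is enough at the next one. There are
`m / 2^j` visits and `O(k j)` searches of `2^j` rows, and the sum over all levels with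
`j 2^j = O(m / k)` is `O(m)` vector-matrix products (`refineCost_le`).

Programs are written in a monad `Code` over computation trees, and their correctness and cost are
stated together by the triples `Runs`.
-/

namespace OneSided

/-! ### Programs and their costs -/

/-- Sequential composition of computation trees: a tree chosen by the output of `p` is grafted to
every leaf of `p`. The second argument of `f` is the number of registers in use at the leaf, when
`n` of them are in use at the root. -/
def Prog.graft {ι α β : Type} : Prog ι α → ℕ → (α → ℕ → Prog ι β) → Prog ι β
  | .ret a, n, f => f a n
  | .op o u v next, n, f => .op o u v (next.graft (n + 1) f)
  | .le u v yes no, n, f => .le u v (yes.graft n f) (no.graft n f)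

/-- A piece of a program, given the number of registers already in use, so that it can name the
registers that it fills. -/
structure Code (ι α : Type) : Type where
  tree : ℕ → Prog ι α

instance {ι : Type} : Monad (Code ι) where
  pure a := ⟨fun _ => .ret a⟩
  bind c f := ⟨fun n => (c.tree n).graft n fun a => (f a).tree⟩

/-- The operand `u` stands for the number `x`, now and after any further operations. -/
def Denotes {ι : Type} (inp : ι → ℝ) (mem : List ℝ) (u : Operand ι) (x : ℝ) : Prop :=
  ∀ ext, u.val inp (mem ++ ext) = x

/-- The Hoare triple of this file: from memory `mem`, the piece `c` executes at most `N` operations,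
and `Q` holds for its output and the memory that it leaves. -/
def Runs {ι α : Type} (inp : ι → ℝ) (mem : List ℝ) (c : Code ι α) (N : ℕ)
    (Q : α → List ℝ → Prop) : Prop :=
  (c.tree mem.length).cost inp mem ≤ N ∧ mem <+: ((c.tree mem.length).exec inp mem).2 ∧
    Q ((c.tree mem.length).exec inp mem).1 ((c.tree mem.length).exec inp mem).2

section Framework

variable {ι α β γ : Type} {inp : ι → ℝ} {mem : List ℝ}

theorem Denotes.mono {mem' : List ℝ} {u : Operand ι} {x : ℝ} (h : Denotes inp mem u x)
    (hle : mem <+: mem') : Denotes inp mem' u x := by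
  obtain ⟨e, rfl⟩ := hle
  intro ext
  rw [List.append_assoc]
  exact h _

theorem Denotes.val_eq {u : Operand ι} {x : ℝ} (h : Denotes inp mem u x) : u.val inp mem = x := by
  simpa using h []

theorem denotes_input (i : ι) : Denotes inp mem (.input i) (inp i) := fun _ => rfl

theorem denotes_const (q : ℚ) : Denotes inp mem (.const q) (q : ℝ) := fun _ => rfl

theorem Prog.exec_graft (p : Prog ι α) (f : α → ℕ → Prog ι β) (mem : List ℝ) :
    (p.graft mem.length f).exec inp mem =
      (f (p.exec inp mem).1 (p.exec inp mem).2.length).exec inp (p.exec inp mem).2 := by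
  induction p generalizing mem with
  | ret a => rfl
  | op o u v next ih =>
    simp only [Prog.graft, Prog.exec]
    rw [← ih]
    simp
  | le u v yes no ih₁ ih₂ =>
    simp only [Prog.graft, Prog.exec]
    split_ifs
    exacts [ih₁ _, ih₂ _]

theorem Prog.cost_graft (p : Prog ι α) (f : α → ℕ → Prog ι β) (mem : List ℝ) :
    (p.graft mem.length f).cost inp mem =
      p.cost inp mem +
        (f (p.exec inp mem).1 (p.exec inp mem).2.length).cost inp (p.exec inp mem).2 := by
  induction p generalizing mem with
  | ret a => simp [Prog.graft, Prog.cost, Prog.exec]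
  | op o u v next ih =>
    simp only [Prog.graft, Prog.exec, Prog.cost]
    rw [add_assoc, ← ih]
    simp
  | le u v yes no ih₁ ih₂ =>
    simp only [Prog.graft, Prog.exec, Prog.cost]
    split_ifs
    · rw [ih₁, add_assoc]
    · rw [ih₂, add_assoc]

theorem Runs.pure {a : α} {N : ℕ} {Q : α → List ℝ → Prop} (h : Q a mem) :
    Runs inp mem (pure a : Code ι α) N Q :=
  ⟨Nat.zero_le _, List.prefix_refl _, h⟩

theorem Runs.bind {c : Code ι α} {f : α → Code ι β} {N N' K : ℕ} {Q : α → List ℝ → Prop}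
    {Q' : β → List ℝ → Prop} (h : Runs inp mem c N Q) (hK : N + N' ≤ K)
    (h' : ∀ a mem', mem <+: mem' → Q a mem' → Runs inp mem' (f a) N' Q') :
    Runs inp mem (c >>= f) K Q' := by
  obtain ⟨h₁, h₂, h₃⟩ := h
  obtain ⟨k₁, k₂, k₃⟩ := h' _ _ h₂ h₃
  have hb : (c >>= f : Code ι β).tree mem.length =
      (c.tree mem.length).graft mem.length fun a => (f a).tree := rfl
  refine ⟨?_, ?_, ?_⟩
  · rw [hb, Prog.cost_graft]
    exact (Nat.add_le_add h₁ k₁).trans hK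
  · rw [hb, Prog.exec_graft]
    exact h₂.trans k₂
  · rw [hb, Prog.exec_graft]
    exact k₃

theorem Runs.weaken {c : Code ι α} {N N' : ℕ} {Q Q' : α → List ℝ → Prop}
    (h : Runs inp mem c N Q) (hN : N ≤ N') (hQ : ∀ a mem', mem <+: mem' → Q a mem' → Q' a mem') :
    Runs inp mem c N' Q' :=
  ⟨h.1.trans hN, h.2.1, hQ _ _ h.2.1 h.2.2⟩

theorem Runs.mono {c : Code ι α} {N N' : ℕ} {Q : α → List ℝ → Prop}
    (h : Runs inp mem c N Q) (hN : N ≤ N') : Runs inp mem c N' Q :=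
  h.weaken hN fun _ _ _ hq => hq

/-! ### Elementary programs -/

/-- A single arithmetic operation. -/
def arith (o : ArithOp) (u v : Operand ι) : Code ι (Operand ι) :=
  ⟨fun n => .op o u v (.ret (.reg n))⟩

theorem runs_arith {o : ArithOp} {u v : Operand ι} {x y : ℝ} (hu : Denotes inp mem u x)
    (hv : Denotes inp mem v y) :
    Runs inp mem (arith o u v) 1 (fun w mem' => Denotes inp mem' w (o.apply x y)) := by
  refine ⟨le_rfl, List.prefix_append _ _, ?_⟩
  intro ext
  simp only [arith, Prog.exec, hu.val_eq, hv.val_eq]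
  simp [Operand.val]

/-- A single comparison. -/
def test (u v : Operand ι) : Code ι Bool := ⟨fun _ => .le u v (.ret true) (.ret false)⟩

theorem runs_test {u v : Operand ι} {x y : ℝ} (hu : Denotes inp mem u x)
    (hv : Denotes inp mem v y) :
    Runs inp mem (test u v) 1 (fun b _ => b = true ↔ x ≤ y) := by
  have h : ((test u v).tree mem.length).exec inp mem = (decide (x ≤ y), mem) := by
    simp only [test, Prog.exec, hu.val_eq, hv.val_eq]
    split_ifs with h <;> simp [h]
  refine ⟨?_, ?_, ?_⟩
  · simp [test, Prog.cost]
  · rw [h]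
  · rw [h]
    simp

/-- Runs `f i` for `i = 0, 1, …` and collects the results. -/
def tabFin : (n : ℕ) → (Fin n → Code ι α) → Code ι (Fin n → α)
  | 0, _ => pure Fin.elim0
  | n + 1, f => do
    let a ← f 0
    let g ← tabFin n (fun i => f i.succ)
    pure (Fin.cons a g)

theorem runs_tabFin {n : ℕ} {f : Fin n → Code ι α} {N : ℕ} {Q : Fin n → α → List ℝ → Prop}
    (hQ : ∀ i a mem₁ mem₂, mem₁ <+: mem₂ → Q i a mem₁ → Q i a mem₂)
    (hf : ∀ i mem', mem <+: mem' → Runs inp mem' (f i) N (Q i)) :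
    Runs inp mem (tabFin n f) (n * N) (fun g mem' => ∀ i, Q i (g i) mem') := by
  induction n generalizing mem with
  | zero => exact Runs.pure fun i => i.elim0
  | succ n ih =>
    refine Runs.bind (hf 0 mem (List.prefix_refl _)) (N' := n * N) (by ring_nf; rfl) ?_
    intro a mem₁ h₁ ha
    refine Runs.bind (ih (fun i => hQ i.succ) fun i mem' h => hf _ _ (h₁.trans h)) (N' := 0)
      (by simp) ?_
    intro g mem₂ h₂ hg
    refine Runs.pure fun i => ?_
    refine Fin.cases ?_ (fun i => ?_) i
    · exact hQ _ _ _ _ h₂ ha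
    · exact hg i

/-- Runs `f b` for every element `b` of a finite type, and collects the results. -/
noncomputable def tab [Fintype β] (f : β → Code ι α) : Code ι (β → α) := do
  let g ← tabFin (Fintype.card β) (fun i => f ((Fintype.equivFin β).symm i))
  pure (fun b => g (Fintype.equivFin β b))

theorem runs_tab [Fintype β] {f : β → Code ι (Operand ι)} {N K : ℕ} {x : β → ℝ}
    (hK : Fintype.card β * N ≤ K)
    (hf : ∀ b mem', mem <+: mem' → Runs inp mem' (f b) N (fun u m => Denotes inp m u (x b))) :
    Runs inp mem (tab f) K (fun u mem' => ∀ b, Denotes inp mem' (u b) (x b)) := by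
  refine Runs.bind (runs_tabFin
    (Q := fun i u m => Denotes inp m u (x ((Fintype.equivFin β).symm i)))
    (fun _ _ _ _ h h' => h'.mono h) fun i => hf _) (N' := 0) (by simpa using hK) ?_
  intro g mem₁ h₁ hg
  refine Runs.pure fun b => ?_
  simpa using hg (Fintype.equivFin β b)

/-- Adds up the values of `f` over a list. -/
def sumList (f : β → Code ι (Operand ι)) : List β → Code ι (Operand ι)
  | [] => pure (.const 0)
  | b :: l => do
    let s ← sumList f l
    let x ← f b
    arith .add x s

theorem runs_sumList {f : β → Code ι (Operand ι)} {N : ℕ} {x : β → ℝ} (l : List β)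
    (hf : ∀ b mem', mem <+: mem' → Runs inp mem' (f b) N (fun u m => Denotes inp m u (x b))) :
    Runs inp mem (sumList f l) (l.length * (N + 1))
      (fun u mem' => Denotes inp mem' u (l.map x).sum) := by
  induction l with
  | nil =>
    refine Runs.pure ?_
    simpa using denotes_const (inp := inp) (mem := mem) (0 : ℚ)
  | cons b l ih =>
    refine Runs.bind ih (N' := N + 1) (by simp; ring_nf; rfl) fun s mem₁ h₁ hs => ?_
    refine Runs.bind (hf b _ h₁) (N' := 1) le_rfl fun y mem₂ h₂ hy => ?_
    exact (runs_arith hy (hs.mono h₂)).weaken le_rfl fun _ _ _ h => by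
      simpa [ArithOp.apply] using h

/-- Adds up the values of `f` over a finite set. -/
noncomputable def sumCode (s : Finset β) (f : β → Code ι (Operand ι)) : Code ι (Operand ι) :=
  sumList f s.toList

theorem runs_sumCode {s : Finset β} {f : β → Code ι (Operand ι)} {N K : ℕ} {x : β → ℝ}
    (hK : s.card * (N + 1) ≤ K)
    (hf : ∀ b mem', mem <+: mem' → Runs inp mem' (f b) N (fun u m => Denotes inp m u (x b))) :
    Runs inp mem (sumCode s f) K (fun u mem' => Denotes inp mem' u (∑ b ∈ s, x b)) := by
  refine (runs_sumList s.toList hf).weaken (by simpa using hK) fun u m _ h => ?_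
  simpa [Finset.sum_map_toList] using h

/-- The first element of a list that passes a test. -/
def findCode (f : β → Code ι Bool) : List β → Code ι (Option β)
  | [] => pure none
  | b :: l => do
    let r ← f b
    if r then pure (some b) else findCode f l

theorem runs_findCode {f : β → Code ι Bool} {N : ℕ} {P : β → Prop} (l : List β)
    (hf : ∀ b ∈ l, ∀ mem', mem <+: mem' → Runs inp mem' (f b) N (fun r _ => r = true ↔ P b)) :
    Runs inp mem (findCode f l) (l.length * N) (fun r _ =>
      (r = none → ∀ b ∈ l, ¬ P b) ∧ ∀ b, r = some b → b ∈ l ∧ P b) := by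
  induction l generalizing mem with
  | nil => exact Runs.pure (by simp)
  | cons b l ih =>
    refine Runs.bind (hf b (by simp) mem (List.prefix_refl _)) (N' := l.length * N)
      (by simp; ring_nf; rfl) fun r mem₁ h₁ hr => ?_
    by_cases hrt : r = true
    · simp only [hrt, if_true]
      refine Runs.pure ⟨by simp, ?_⟩
      rintro b' hb'
      obtain rfl : b = b' := by simpa using hb'
      exact ⟨by simp, hr.1 hrt⟩
    · simp only [hrt]
      refine (ih fun b' hb' mem' h => hf b' (by simp [hb']) _ (h₁.trans h)).weaken le_rfl ?_
      rintro r' _ _ ⟨h₂, h₃⟩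
      refine ⟨fun h b' hb' => ?_, fun b' h => ⟨by simp [(h₃ b' h).1], (h₃ b' h).2⟩⟩
      rcases List.mem_cons.1 hb' with rfl | hb'
      · exact fun hp => hrt (hr.2 hp)
      · exact h₂ h b' hb'

/-- An element of the list `b :: l` at which the numbers `u` are largest. -/
def argmax (u : β → Operand ι) : β → List β → Code ι β
  | b, [] => pure b
  | b, b' :: l => do
    let r ← test (u b) (u b')
    if r then argmax u b' l else argmax u b l

theorem runs_argmax {u : β → Operand ι} {x : β → ℝ} (b : β) (l : List β)
    (hu : ∀ b' ∈ b :: l, Denotes inp mem (u b') (x b')) :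
    Runs inp mem (argmax u b l) l.length
      (fun a _ => a ∈ b :: l ∧ ∀ b' ∈ b :: l, x b' ≤ x a) := by
  induction l generalizing b mem with
  | nil => exact Runs.pure (by simp)
  | cons c l ih =>
    refine Runs.bind (runs_test (hu b (by simp)) (hu c (by simp))) (N' := l.length)
      (by simp; omega) fun r mem₁ h₁ hr => ?_
    by_cases hrt : r = true
    · simp only [hrt, if_true]
      refine (ih c fun b' hb' => (hu b' (by simp at hb' ⊢; tauto)).mono h₁).weaken le_rfl ?_
      rintro a _ _ ⟨ha, h⟩
      refine ⟨List.mem_cons_of_mem _ ha, fun b' hb' => ?_⟩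
      rcases List.mem_cons.1 hb' with rfl | hb'
      · exact (hr.1 hrt).trans (h c (by simp))
      · exact h _ hb'
    · simp only [hrt]
      refine (ih b fun b' hb' => (hu b' (by simp at hb' ⊢; tauto)).mono h₁).weaken le_rfl ?_
      rintro a _ _ ⟨ha, h⟩
      refine ⟨by simp at ha ⊢; tauto, fun b' hb' => ?_⟩
      rcases List.mem_cons.1 hb' with rfl | hb'
      · exact h _ (by simp)
      · rcases List.mem_cons.1 hb' with rfl | hb'
        · exact (le_of_lt (not_le.1 fun hp => hrt (hr.2 hp))).trans (h b (by simp))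
        · exact h _ (by simp [hb'])

end Framework

/-! ### Sampling -/

section Sampling

variable {ι β : Type} {inp : ι → ℝ} {mem : List ℝ}

/-- The smallest of the values of `f` on the list `b :: l`. -/
def minCode (f : β → Code ι (Operand ι)) : β → List β → Code ι (Operand ι)
  | b, [] => f b
  | b, b' :: l => do
    let u ← f b
    let v ← minCode f b' l
    let r ← test u v
    pure (if r then u else v)

theorem runs_minCode {f : β → Code ι (Operand ι)} {N : ℕ} {x : β → ℝ} (b : β) (l : List β)
    (hf : ∀ b mem', mem <+: mem' → Runs inp mem' (f b) N (fun u m => Denotes inp m u (x b))) :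
    Runs inp mem (minCode f b l) ((l.length + 1) * (N + 1)) (fun u mem' =>
      ∃ a ∈ b :: l, Denotes inp mem' u (x a) ∧ ∀ b' ∈ b :: l, x a ≤ x b') := by
  induction l generalizing b mem with
  | nil =>
    refine (hf b mem (List.prefix_refl _)).weaken (by simp) fun u m _ h => ?_
    exact ⟨b, by simp, h, by simp⟩
  | cons c l ih =>
    refine Runs.bind (hf b mem (List.prefix_refl _)) (N' := (l.length + 1) * (N + 1) + 1)
      (by simp only [List.length_cons]; ring_nf; rfl) fun u mem₁ h₁ hu => ?_
    refine Runs.bind (ih c fun b' m h => hf b' m (h₁.trans h)) le_rfl fun v mem₂ h₂ hv => ?_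
    obtain ⟨a, ha, hv, hmin⟩ := hv
    refine Runs.bind (runs_test (hu.mono h₂) hv) (N' := 0) le_rfl fun r mem₃ h₃ hr => ?_
    refine Runs.pure ?_
    by_cases hrt : r = true
    · simp only [hrt, if_true]
      refine ⟨b, by simp, hu.mono (h₂.trans h₃), fun b' hb' => ?_⟩
      rcases List.mem_cons.1 hb' with rfl | hb'
      · exact le_rfl
      · exact (hr.1 hrt).trans (hmin _ hb')
    · simp only [hrt]
      refine ⟨a, List.mem_cons_of_mem _ ha, hv.mono h₃, fun b' hb' => ?_⟩
      rcases List.mem_cons.1 hb' with rfl | hb'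
      · exact le_of_lt (not_le.1 fun h => hrt (hr.2 h))
      · exact hmin _ hb'

/-- The square of the distance between two input points. -/
noncomputable def sqDistCode {d n : ℕ} (i j : Fin n) :
    Code (Fin n × Fin d) (Operand (Fin n × Fin d)) :=
  sumCode (Finset.univ : Finset (Fin d)) fun c => do
    let t ← arith .sub (.input (i, c)) (.input (j, c))
    arith .mul t t

theorem runs_sqDistCode {d n : ℕ} (Y : Fin n → Pt d) (i j : Fin n) :
    Runs (fun e : Fin n × Fin d => Y e.1 e.2) mem (sqDistCode i j) (3 * d)
      (fun u m => Denotes (fun e : Fin n × Fin d => Y e.1 e.2) m u (dist (Y i) (Y j) ^ 2)) := by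
  have hd : dist (Y i) (Y j) ^ 2 = ∑ c, (Y i c - Y j c) * (Y i c - Y j c) := by
    rw [EuclideanSpace.dist_eq, Real.sq_sqrt (Finset.sum_nonneg fun _ _ => sq_nonneg _)]
    refine Finset.sum_congr rfl fun c _ => ?_
    rw [Real.dist_eq, sq_abs, sq]
  rw [hd]
  refine runs_sumCode (N := 2) (by simp [mul_comm]) fun c mem' _ => ?_
  exact Runs.bind (runs_arith (denotes_input _) (denotes_input _)) (N' := 1) le_rfl
    fun t mem₁ _ ht => runs_arith ht ht

/-- The unselected points, in the order `π`. -/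
def unselected {n : ℕ} (π : Equiv.Perm (Fin n)) (prev : List (Fin n)) : List (Fin n) :=
  ((List.finRange n).map π).filter fun j => j ∉ prev

theorem mem_unselected {n : ℕ} {π : Equiv.Perm (Fin n)} {prev : List (Fin n)} {j : Fin n} :
    j ∈ unselected π prev ↔ j ∉ prev := by
  simp only [unselected, List.mem_filter, List.mem_map, List.mem_finRange, true_and,
    decide_eq_true_eq, and_iff_right_iff_imp]
  exact fun _ => ⟨π.symm j, by simp⟩

theorem pairwise_unselected {n : ℕ} (π : Equiv.Perm (Fin n)) (prev : List (Fin n)) :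
    (unselected π prev).Pairwise fun a b => π.symm a ≤ π.symm b := by
  refine List.Pairwise.filter _ (List.pairwise_map.2 ?_)
  refine (List.pairwise_lt_finRange n).imp fun h => ?_
  simpa using h.le

theorem length_unselected_le {n : ℕ} (π : Equiv.Perm (Fin n)) (prev : List (Fin n)) :
    (unselected π prev).length ≤ n :=
  (List.length_filter_le _ _).trans (by simp)

/-- Appends one sample point to the list of those selected so far. -/
noncomputable def nextPoint {d n : ℕ} (p : ℕ) (π : Equiv.Perm (Fin n)) (prev : List (Fin n)) :
    Code (Fin n × Fin d) (List (Fin n)) :=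
  match unselected π prev, prev with
  | [], _ => pure prev
  | a :: _, [] => pure (prev ++ [a])
  | a :: l, q :: qs =>
    if p ≤ prev.length then pure (prev ++ [a])
    else do
      let D ← tab fun j : Fin n => minCode (fun i => sqDistCode j i) q qs
      let j ← argmax D a l
      pure (prev ++ [j])

/-- The list of the first points of a sample may be continued by `x`. -/
structure IsNext {d n : ℕ} (Y : Fin n → Pt d) (p : ℕ) (π : Equiv.Perm (Fin n))
    (prev : List (Fin n)) (x : Fin n) : Prop where
  notMem : x ∉ prev
  random : (prev.length = 0 ∨ p ≤ prev.length) → ∀ j, j ∉ prev → π.symm x ≤ π.symm j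
  farthest : 0 < prev.length → prev.length < p → ∀ j, j ∉ prev →
    Metric.infDist (Y j) (Y '' {i | i ∈ prev}) ≤ Metric.infDist (Y x) (Y '' {i | i ∈ prev})

theorem runs_nextPoint {d n : ℕ} (Y : Fin n → Pt d) (p : ℕ) (π : Equiv.Perm (Fin n))
    (prev : List (Fin n)) (hprev : prev.length < n) :
    Runs (fun e : Fin n × Fin d => Y e.1 e.2) mem (nextPoint p π prev)
      (n * (prev.length * (3 * d + 1)) + n)
      (fun l _ => ∃ x, l = prev ++ [x] ∧ IsNext Y p π prev x) := by
  have hmem : ∀ j, j ∈ unselected π prev ↔ j ∉ prev := fun j => mem_unselected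
  have hsort := pairwise_unselected π prev
  have hlen := length_unselected_le π prev
  have hne : unselected π prev ≠ [] := by
    intro h
    have hall : ∀ j, j ∈ prev := fun j => by
      have := hmem j
      rw [h] at this
      simpa using this
    have : Fintype.card (Fin n) ≤ prev.toFinset.card :=
      Finset.card_le_card fun j _ => by simpa using hall j
    have h' := List.toFinset_card_le prev
    simp at this
    omega
  unfold nextPoint
  rcases hU : unselected π prev with _ | ⟨a, l⟩
  · exact absurd hU hne
  rw [hU] at hmem hsort hlen
  have ha : a ∉ prev := (hmem a).1 (by simp)
  have hfirst : ∀ j, j ∉ prev → π.symm a ≤ π.symm j := fun j hj => by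
    rcases List.mem_cons.1 ((hmem j).2 hj) with rfl | h
    · exact le_rfl
    · exact (List.pairwise_cons.1 hsort).1 j h
  rcases prev with _ | ⟨q, qs⟩
  · refine Runs.pure ?_
    exact ⟨a, rfl, ha, fun _ => hfirst, fun h => absurd h (by simp)⟩
  simp only
  generalize hP : q :: qs = prev at *
  split_ifs with hp
  · refine Runs.pure ?_
    exact ⟨a, rfl, ha, fun _ => hfirst, fun _ h => absurd h (by omega)⟩
  have hinf : ∀ j i, i ∈ prev → (∀ i' ∈ prev, dist (Y j) (Y i) ^ 2 ≤ dist (Y j) (Y i') ^ 2) →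
      dist (Y j) (Y i) = Metric.infDist (Y j) (Y '' {i | i ∈ prev}) := by
    intro j i hi hmin
    refine le_antisymm ?_ (Metric.infDist_le_dist_of_mem ⟨i, hi, rfl⟩)
    refine (Metric.le_infDist (s := Y '' {i | i ∈ prev}) ⟨Y i, Set.mem_image_of_mem Y hi⟩).2 ?_
    rintro _ ⟨i', hi', rfl⟩
    exact (sq_le_sq₀ dist_nonneg dist_nonneg).1 (hmin i' hi')
  refine Runs.bind (runs_tab (N := prev.length * (3 * d + 1)) (x := fun j =>
    Metric.infDist (Y j) (Y '' {i | i ∈ prev}) ^ 2)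
    (K := n * (prev.length * (3 * d + 1))) (by simp) ?_) (N' := n) le_rfl ?_
  · intro j mem' _
    refine (runs_minCode q qs fun i m _ => runs_sqDistCode Y j i).weaken (by simp [← hP]) ?_
    rintro u m _ ⟨i, hi, hu, hmin⟩
    rw [hP] at hi hmin
    rwa [← hinf j i hi hmin]
  · intro D mem₁ h₁ hD
    refine Runs.bind (runs_argmax (x := fun j =>
      Metric.infDist (Y j) (Y '' {i | i ∈ prev}) ^ 2) a l fun j _ => hD j) (N' := 0)
      (by simp at hlen; omega) ?_
    rintro j mem₂ h₂ ⟨hj, hmax⟩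
    refine Runs.pure ⟨j, rfl, (hmem j).1 hj, fun h => ?_, fun _ _ i hi => ?_⟩
    · rcases h with h | h
      · simp [← hP] at h
      · exact absurd h hp
    · exact (sq_le_sq₀ Metric.infDist_nonneg Metric.infDist_nonneg).1 (hmax i ((hmem i).2 hi))

/-- Appends `t` sample points to the list of those selected so far. -/
noncomputable def sampleList {d n : ℕ} (p : ℕ) (π : Equiv.Perm (Fin n)) :
    ℕ → List (Fin n) → Code (Fin n × Fin d) (List (Fin n))
  | 0, prev => pure prev
  | t + 1, prev => do
    let l ← nextPoint p π prev
    sampleList p π t l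

theorem runs_sampleList {d n r : ℕ} (hr : r ≤ n) (Y : Fin n → Pt d) (p : ℕ)
    (π : Equiv.Perm (Fin n)) (t : ℕ) (prev : List (Fin n)) (ht : prev.length + t = r)
    (hprev : ∀ k (hk : k < prev.length), IsNext Y p π (prev.take k) prev[k]) :
    Runs (fun e : Fin n × Fin d => Y e.1 e.2) mem (sampleList p π t prev)
      (t * (n * (r * (3 * d + 1)) + n)) (fun l _ => l.length = r ∧
        ∀ k (hk : k < l.length), IsNext Y p π (l.take k) l[k]) := by
  induction t generalizing prev mem with
  | zero => exact Runs.pure ⟨by simpa using ht, hprev⟩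
  | succ t ih =>
    refine Runs.bind ((runs_nextPoint Y p π prev (by omega)).mono
      (N' := n * (r * (3 * d + 1)) + n) ?_) (N' := t * (n * (r * (3 * d + 1)) + n))
      (by ring_nf; rfl) ?_
    · have : prev.length ≤ r := by omega
      gcongr
    · rintro _ mem₁ h₁ ⟨x, rfl, hx⟩
      refine ih _ (by simp; omega) fun k hk => ?_
      rcases (Nat.lt_succ_iff_lt_or_eq.1 (by simpa using hk : k < prev.length + 1)) with h | rfl
      · rw [List.take_append_of_le_length h.le, List.getElem_append_left h]
        exact hprev k h
      · simpa using hx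

/-- The list `l` as an injective family; the first points if `l` is not a list of `r` distinct
indices. -/
def toEmbedding {n r : ℕ} (hr : r ≤ n) (l : List (Fin n)) : Fin r ↪ Fin n :=
  if h : l.length = r ∧ l.Nodup then
    ⟨fun i => l.get (i.cast h.1.symm), fun i j hij => by
      have := List.nodup_iff_injective_get.1 h.2 hij
      simpa [Fin.ext_iff] using this⟩
  else Fin.castLEEmb hr

/-- At every step the distances of all points to the sample are recomputed from the coordinates. -/
theorem exists_sampling_program :
    ∃ c : ℕ, ∀ (d n r p : ℕ) (π : Equiv.Perm (Fin n)), 0 < d → 0 < r → r ≤ n →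
      ∃ sel : SelProg d n r, ∀ Y : Fin n → Pt d,
        IsSample Y p π (sel.result Y) ∧ sel.ops Y ≤ c * (d * r ^ 2 * n) := by
  refine ⟨5, fun d n r p π hd hr hrn => ?_⟩
  refine ⟨(do let l ← sampleList p π r []; pure (toEmbedding hrn l) :
    Code (Fin n × Fin d) (Fin r ↪ Fin n)).tree 0, fun Y => ?_⟩
  have hrun : Runs (fun e : Fin n × Fin d => Y e.1 e.2) []
      (do let l ← sampleList p π r []; pure (toEmbedding hrn l) :
        Code (Fin n × Fin d) (Fin r ↪ Fin n)) (5 * (d * r ^ 2 * n))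
      (fun s _ => IsSample Y p π s) := by
    refine Runs.bind (runs_sampleList hrn Y p π r [] (by simp) (by simp)) (N' := 0) ?_ ?_
    · have h₁ : r * n * 1 ≤ r * n * (d * r) := Nat.mul_le_mul_left _ (Nat.mul_pos hd hr)
      have h₂ : r * n * r * 1 ≤ r * n * r * d := Nat.mul_le_mul_left _ hd
      nlinarith
    · rintro l mem' _ ⟨hl, hnext⟩
      have hnodup : l.Nodup := by
        rw [List.nodup_iff_injective_get]
        intro i j hij
        by_contra hne
        wlog h : i < j generalizing i j
        · exact this hij.symm (fun h => hne h.symm)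
            (lt_of_le_of_ne (not_lt.1 h) (fun h => hne h.symm))
        refine (hnext j j.2).notMem ?_
        rw [List.mem_take_iff_getElem]
        exact ⟨i, by simpa using h, by simpa using hij⟩
      have hs : ∀ i : Fin r, toEmbedding hrn l i = l[(i : ℕ)]'(by omega) := fun i => by
        simp [toEmbedding, hl, hnodup]
      have htake : ∀ (k : Fin r) (j : Fin n), j ∈ l.take k ↔
          ∃ i, i < k ∧ toEmbedding hrn l i = j := by
        intro k j
        rw [List.mem_take_iff_getElem]
        constructor
        · rintro ⟨i, hi, rfl⟩
          have := k.2
          exact ⟨⟨i, by omega⟩, Fin.lt_def.2 (by simp; omega), hs _⟩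
        · rintro ⟨i, hi, rfl⟩
          have := k.2
          exact ⟨i, by have := Fin.lt_def.1 hi; omega, (hs i).symm⟩
      have himage : ∀ k : Fin r, (fun i => Y (toEmbedding hrn l i)) '' {i | i < k} =
          Y '' {i | i ∈ l.take k} := by
        intro k
        ext y
        simp only [Set.mem_image, Set.mem_ofPred_eq, htake]
        constructor
        · rintro ⟨i, hi, rfl⟩
          exact ⟨_, ⟨i, hi, rfl⟩, rfl⟩
        · rintro ⟨_, ⟨i, hi, rfl⟩, rfl⟩
          exact ⟨i, hi, rfl⟩
      have hnot : ∀ (k : Fin r) (j : Fin n), (∀ i, i < k → toEmbedding hrn l i ≠ j) →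
          j ∉ l.take k := fun k j h hj => by
        obtain ⟨i, hi, hij⟩ := (htake k j).1 hj
        exact h i hi hij
      have hlen : ∀ k : Fin r, (l.take k).length = k := fun k => by
        have := k.2
        simp; omega
      refine Runs.pure ⟨fun k hk j hj => ?_, fun k hk hkp j hj => ?_⟩
      · rw [hs]
        exact (hnext k (by omega)).random (by rwa [hlen]) j (hnot k j hj)
      · rw [himage, hs]
        exact (hnext k (by omega)).farthest (by rwa [hlen]) (by rwa [hlen]) j (hnot k j hj)
  exact ⟨hrun.2.2, hrun.1⟩

end Sampling

open Matrix

set_option linter.unusedSectionVars false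

/-! ### Designs and leverages -/

section Design

variable {β γ : Type} [Fintype β] [Fintype γ] [DecidableEq β] [DecidableEq γ]

/-- The inequality of the means for the eigenvalues. -/
theorem det_le_trace_div_pow {P : Matrix γ γ ℝ} (hP : P.PosSemidef) :
    P.det ≤ (P.trace / Fintype.card γ) ^ Fintype.card γ := by
  rcases isEmpty_or_nonempty γ with h | h
  · simp
  have hc : (0 : ℝ) < Fintype.card γ := by exact_mod_cast Fintype.card_pos
  have hdet : P.det = ∏ i, hP.1.eigenvalues i := by simpa using hP.1.det_eq_prod_eigenvalues
  have htr : P.trace = ∑ i, hP.1.eigenvalues i := by simpa using hP.1.trace_eq_sum_eigenvalues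
  have hnn : ∀ i ∈ Finset.univ, 0 ≤ hP.1.eigenvalues i := fun i _ => hP.eigenvalues_nonneg i
  have := Real.geom_mean_le_arith_mean Finset.univ (fun _ => 1) hP.1.eigenvalues
    (fun _ _ => zero_le_one) (by simpa using hc) hnn
  simp only [Real.rpow_one, Finset.sum_const, Finset.card_univ, nsmul_eq_mul, mul_one,
    one_mul] at this
  rw [hdet, htr]
  calc _ = ((∏ i, hP.1.eigenvalues i) ^ ((Fintype.card γ : ℝ)⁻¹)) ^ Fintype.card γ := by
        rw [← Real.rpow_natCast, ← Real.rpow_mul (Finset.prod_nonneg hnn),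
          inv_mul_cancel₀ hc.ne', Real.rpow_one]
    _ ≤ _ := pow_le_pow_left₀ (Real.rpow_nonneg (Finset.prod_nonneg hnn) _) this _

open scoped MatrixOrder in
theorem det_mul_le_trace_div_pow {P Q : Matrix γ γ ℝ} (hP : P.PosSemidef) (hQ : Q.PosSemidef) :
    (P * Q).det ≤ ((P * Q).trace / Fintype.card γ) ^ Fintype.card γ := by
  obtain ⟨B, rfl⟩ := CStarAlgebra.nonneg_iff_eq_star_mul_self.mp hP.nonneg
  have h := det_le_trace_div_pow (hQ.mul_mul_conjTranspose_same B)
  rw [star_eq_conjTranspose, Matrix.mul_assoc, det_mul_comm, Matrix.trace_mul_comm]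
  exact h

/-- The moment matrix `∑ wᵢ vᵢ vᵢᵀ` of the rows `vᵢ` of `V` with weights `wᵢ`. -/
def moment (V : Matrix β γ ℝ) (w : β → ℝ) : Matrix γ γ ℝ := Vᵀ * diagonal w * V

/-- The leverage `vᵢᵀ H vᵢ` of row `i`. -/
def leverage (V : Matrix β γ ℝ) (H : Matrix γ γ ℝ) (i : β) : ℝ := V i ⬝ᵥ (H *ᵥ V i)

theorem moment_apply (V : Matrix β γ ℝ) (w : β → ℝ) (a b : γ) :
    moment V w a b = ∑ i, w i * (V i a * V i b) := by
  rw [moment, Matrix.mul_apply]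
  simp only [mul_diagonal, transpose_apply]
  exact Finset.sum_congr rfl fun i _ => by ring

theorem moment_add_single (V : Matrix β γ ℝ) (w : β → ℝ) (i : β) (c : ℝ) :
    moment V (w + Pi.single i c) = moment V w + c • vecMulVec (V i) (V i) := by
  ext a b
  simp only [moment_apply, Matrix.add_apply, Pi.add_apply, add_mul, Finset.sum_add_distrib,
    Matrix.smul_apply, vecMulVec_apply, smul_eq_mul]
  congr 1
  rw [Finset.sum_eq_single i]
  · simp
  · intro j _ hj
    simp [Pi.single_eq_of_ne hj]
  · simp

theorem moment_smul (V : Matrix β γ ℝ) (w : β → ℝ) (c : ℝ) :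
    moment V (c • w) = c • moment V w := by
  ext a b
  simp only [moment_apply, Matrix.smul_apply, Pi.smul_apply, smul_eq_mul, Finset.mul_sum]
  exact Finset.sum_congr rfl fun i _ => by ring

theorem posSemidef_moment (V : Matrix β γ ℝ) {w : β → ℝ} (hw : ∀ i, 0 ≤ w i) :
    (moment V w).PosSemidef := by
  have := (PosSemidef.diagonal (n := β) (d := w) hw).conjTranspose_mul_mul_same V
  simpa [moment] using this

theorem isSymm_moment (V : Matrix β γ ℝ) (w : β → ℝ) : (moment V w)ᵀ = moment V w := by
  ext a b
  simp only [transpose_apply, moment_apply]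
  exact Finset.sum_congr rfl fun i _ => by ring

/-- The inner product of `H` with a moment matrix is a weighted sum of leverages. -/
theorem sum_mul_leverage (V : Matrix β γ ℝ) (w : β → ℝ) (H : Matrix γ γ ℝ) :
    ∑ i, w i * leverage V H i = (H * moment V w).trace := by
  simp only [leverage, dotProduct, mulVec, Matrix.trace, Matrix.diag_apply, Matrix.mul_apply,
    moment_apply, Finset.mul_sum]
  rw [Finset.sum_comm]
  refine Finset.sum_congr rfl fun a _ => ?_
  rw [Finset.sum_comm]
  exact Finset.sum_congr rfl fun b _ => Finset.sum_congr rfl fun i _ => by ring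

/-- The weights `w` are nonnegative and `H` is the inverse of their moment matrix. -/
structure IsDesign (V : Matrix β γ ℝ) (w : β → ℝ) (H : Matrix γ γ ℝ) : Prop where
  nonneg : ∀ i, 0 ≤ w i
  mul_eq_one : moment V w * H = 1

namespace IsDesign

variable {V : Matrix β γ ℝ} {w : β → ℝ} {H : Matrix γ γ ℝ}

theorem mul_eq_one' (h : IsDesign V w H) : H * moment V w = 1 :=
  mul_eq_one_comm.1 h.mul_eq_one

theorem posDef_moment (h : IsDesign V w H) : (moment V w).PosDef :=
  (posSemidef_moment V h.nonneg).posDef_iff_isUnit.2 (IsUnit.of_mul_eq_one _ h.mul_eq_one)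

theorem posDef (h : IsDesign V w H) : H.PosDef := by
  have : (moment V w)⁻¹ = H := inv_eq_right_inv h.mul_eq_one
  exact this ▸ h.posDef_moment.inv

theorem isSymm (h : IsDesign V w H) : Hᵀ = H := by
  simpa using h.posDef.1.eq

theorem leverage_nonneg (h : IsDesign V w H) (i : β) : 0 ≤ leverage V H i := by
  simpa [leverage] using h.posDef.posSemidef.dotProduct_mulVec_nonneg (V i)

theorem sum_leverage (h : IsDesign V w H) : ∑ i, w i * leverage V H i = Fintype.card γ := by
  rw [sum_mul_leverage, h.mul_eq_one', Matrix.trace_one]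

theorem smul (h : IsDesign V w H) {c : ℝ} (hc : 0 < c) : IsDesign V (c⁻¹ • w) (c • H) where
  nonneg i := mul_nonneg (inv_nonneg.2 hc.le) (h.nonneg i)
  mul_eq_one := by
    rw [moment_smul, Matrix.smul_mul, Matrix.mul_smul, smul_smul, inv_mul_cancel₀ hc.ne', one_smul,
      h.mul_eq_one]

end IsDesign

/-- The symmetric rank one modification `H - u uᵀ / d` with `u = H v`. -/
noncomputable def deflate (H : Matrix γ γ ℝ) (v : γ → ℝ) (d : ℝ) : Matrix γ γ ℝ :=
  H - d⁻¹ • vecMulVec (H *ᵥ v) (H *ᵥ v)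

theorem isSymm_deflate {H : Matrix γ γ ℝ} (hH : Hᵀ = H) (v : γ → ℝ) (d : ℝ) :
    (deflate H v d)ᵀ = deflate H v d := by
  simp [deflate, hH, transpose_vecMulVec]

theorem leverage_deflate {V : Matrix β γ ℝ} (H : Matrix γ γ ℝ) (v : γ → ℝ) (d : ℝ) (i : β) :
    leverage V (deflate H v d) i = leverage V H i - (V i ⬝ᵥ (H *ᵥ v)) ^ 2 / d := by
  simp only [leverage, deflate, sub_mulVec, smul_mulVec, dotProduct_sub, dotProduct_smul,
    vecMulVec_mulVec, smul_eq_mul]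
  rw [sub_right_inj, sq, div_eq_mul_inv, dotProduct_comm (H *ᵥ v) (V i)]
  simp
  ring

theorem vecMul_eq_mulVec {H : Matrix γ γ ℝ} (hH : Hᵀ = H) (v : γ → ℝ) : v ᵥ* H = H *ᵥ v := by
  rw [← mulVec_transpose, hH]

namespace IsDesign

variable {V : Matrix β γ ℝ} {w : β → ℝ} {H : Matrix γ γ ℝ}

/-- The Sherman–Morrison formula: adding one to the weight of row `i`. -/
theorem add_single (h : IsDesign V w H) (i : β) :
    IsDesign V (w + Pi.single i 1) (deflate H (V i) (1 + leverage V H i)) where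
  nonneg j := add_nonneg (h.nonneg j) (by
    rcases eq_or_ne j i with rfl | hj
    · simp
    · simp [Pi.single_eq_of_ne hj])
  mul_eq_one := by
    have hd : 1 + leverage V H i ≠ 0 := by
      have := h.leverage_nonneg i
      positivity
    have hA : moment V w *ᵥ (H *ᵥ V i) = V i := by
      rw [mulVec_mulVec, h.mul_eq_one, one_mulVec]
    rw [moment_add_single, one_smul, deflate, Matrix.mul_sub, Matrix.add_mul, h.mul_eq_one,
      vecMulVec_mul, vecMul_eq_mulVec h.isSymm, Matrix.mul_smul, Matrix.add_mul, mul_vecMulVec, hA,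
      vecMulVec_mul_vecMulVec]
    ext a b
    simp only [Matrix.sub_apply, Matrix.add_apply, Matrix.smul_apply, vecMulVec_apply, smul_eq_mul,
      Pi.smul_apply]
    have : V i ⬝ᵥ H *ᵥ V i = leverage V H i := rfl
    rw [this]
    field_simp
    ring

theorem det_add_single (h : IsDesign V w H) (i : β) :
    (moment V (w + Pi.single i 1)).det = (moment V w).det * (1 + leverage V H i) := by
  have hu : IsUnit (moment V w).det := h.posDef_moment.det_pos.ne'.isUnit
  rw [moment_add_single, one_smul, vecMulVec_eq Unit, det_add_replicateCol_mul_replicateRow hu,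
    inv_eq_right_inv h.mul_eq_one, det_unique (n := Unit), Matrix.mul_assoc]
  congr 1

/-- Adding `k * q` rows of leverage at most `L` multiplies the determinant of the moment matrix by at
most `(1 + q * L) ^ k`. Therefore it cannot have doubled with each of these rows, if `q` is so large
that `1 + q * L < 2 ^ q`. -/
theorem not_two_pow_le {w₀ : β → ℝ} {H₀ : Matrix γ γ ℝ} [Nonempty γ] (h₀ : IsDesign V w₀ H₀)
    (h : IsDesign V w H) {q : ℕ} {L : ℝ} (hq : 1 + q * L < 2 ^ q)
    (htr : (H₀ * moment V w).trace ≤ Fintype.card γ + (Fintype.card γ * q : ℕ) * L) :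
    ¬ 2 ^ (Fintype.card γ * q) * (moment V w₀).det ≤ (moment V w).det := by
  intro hdet
  have hc : (0 : ℝ) < Fintype.card γ := by exact_mod_cast Fintype.card_pos
  have h₁ := det_mul_le_trace_div_pow h₀.posDef.posSemidef (posSemidef_moment V h.nonneg)
  have h₂ : (H₀ * moment V w).trace / Fintype.card γ ≤ 1 + q * L := by
    rw [div_le_iff₀ hc]
    push_cast at htr
    linarith
  have h₃ : 0 ≤ (H₀ * moment V w).trace / Fintype.card γ := by
    rw [← sum_mul_leverage]
    exact div_nonneg (Finset.sum_nonneg fun i _ => mul_nonneg (h.nonneg i) (h₀.leverage_nonneg i))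
      hc.le
  have h₄ : H₀.det * (moment V w₀).det = 1 := by rw [← det_mul, h₀.mul_eq_one', det_one]
  have h₅ : (2 : ℝ) ^ (Fintype.card γ * q) ≤ (H₀ * moment V w).det := by
    rw [det_mul]
    calc (2 : ℝ) ^ (Fintype.card γ * q)
        = H₀.det * (2 ^ (Fintype.card γ * q) * (moment V w₀).det) := by
          rw [mul_left_comm, h₄, mul_one]
      _ ≤ _ := mul_le_mul_of_nonneg_left hdet h₀.posDef.det_pos.le
  have h₆ : ((H₀ * moment V w).trace / Fintype.card γ) ^ Fintype.card γ < (2 ^ q) ^ Fintype.card γ :=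
    pow_lt_pow_left₀ (h₂.trans_lt hq) h₃ Fintype.card_ne_zero
  rw [← pow_mul, mul_comm q] at h₆
  linarith

/-- If all leverages are at most one, the moment matrix dominates the determinants of all square
row submatrices. -/
theorem det_sq_le (h : IsDesign V w H) (hlev : ∀ i, leverage V H i ≤ 1) (ρ : γ → β) :
    (V.submatrix ρ id).det ^ 2 ≤ (moment V w).det := by
  have hpsd := h.posDef.posSemidef.mul_mul_conjTranspose_same (V.submatrix ρ id)
  have h₁ := det_le_trace_div_pow hpsd
  have htr : (V.submatrix ρ id * H * (V.submatrix ρ id)ᴴ).trace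
      = ∑ a, leverage V H (ρ a) := by
    simp only [Matrix.trace, Matrix.diag_apply, Matrix.mul_apply, leverage, dotProduct, mulVec,
      conjTranspose_apply, submatrix_apply, id, star_trivial, Finset.mul_sum, Finset.sum_mul]
    refine Finset.sum_congr rfl fun a _ => ?_
    rw [Finset.sum_comm]
    exact Finset.sum_congr rfl fun b _ => Finset.sum_congr rfl fun i _ => by ring
  have h₂ : (∑ a, leverage V H (ρ a)) / Fintype.card γ ≤ 1 := by
    refine div_le_one_of_le₀ ?_ (Nat.cast_nonneg _)
    simpa using Finset.sum_le_sum fun a (_ : a ∈ Finset.univ) => hlev (ρ a)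
  have h₃ : 0 ≤ (∑ a, leverage V H (ρ a)) / Fintype.card γ :=
    div_nonneg (Finset.sum_nonneg fun a _ => h.leverage_nonneg _) (Nat.cast_nonneg _)
  rw [htr, det_mul, det_mul, det_conjTranspose, star_trivial] at h₁
  have h₄ : (moment V w).det * H.det = 1 := by rw [← det_mul, h.mul_eq_one, det_one]
  have hpos := h.posDef_moment.det_pos
  have h₅ := h₁.trans (pow_le_one₀ h₃ h₂)
  calc (V.submatrix ρ id).det ^ 2
      = (moment V w).det * ((V.submatrix ρ id).det * H.det * (V.submatrix ρ id).det) := by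
        linear_combination -(V.submatrix ρ id).det ^ 2 * h₄
    _ ≤ (moment V w).det * 1 := mul_le_mul_of_nonneg_left h₅ hpos.le
    _ = _ := mul_one _

end IsDesign

end Design

/-! ### Greedy selection of rows -/

section Greedy

variable {β γ : Type} [Fintype β] [Fintype γ] [DecidableEq β] [DecidableEq γ]

/-- `H` is what remains of the inverse of the moment matrix after the deflation by some of the rows:
it is a symmetric generalized inverse, and the leverages have the weighted sum `t`. -/
structure IsDeflated (V : Matrix β γ ℝ) (w : β → ℝ) (H : Matrix γ γ ℝ) (t : ℕ) : Prop where
  nonneg : ∀ i, 0 ≤ w i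
  isSymm : Hᵀ = H
  mul_mul : H * moment V w * H = H
  sum_eq : ∑ i, w i * leverage V H i = t

theorem IsDesign.isDeflated {V : Matrix β γ ℝ} {w : β → ℝ} {H : Matrix γ γ ℝ}
    (h : IsDesign V w H) : IsDeflated V w H (Fintype.card γ) where
  nonneg := h.nonneg
  isSymm := h.isSymm
  mul_mul := by rw [h.mul_eq_one', Matrix.one_mul]
  sum_eq := h.sum_leverage

namespace IsDeflated

variable {V : Matrix β γ ℝ} {w : β → ℝ} {H : Matrix γ γ ℝ} {t : ℕ}

/-- The largest leverage is at least the weighted mean. -/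
theorem le_leverage (h : IsDeflated V w H t) {W : ℝ} (hW : 0 < W) (hw : ∑ i, w i ≤ W) {p : β}
    (hp : ∀ i, leverage V H i ≤ leverage V H p) (ht : 0 < t) : t / W ≤ leverage V H p := by
  have h₁ : (t : ℝ) ≤ (∑ i, w i) * leverage V H p := by
    rw [← h.sum_eq, Finset.sum_mul]
    exact Finset.sum_le_sum fun i _ => mul_le_mul_of_nonneg_left (hp i) (h.nonneg i)
  have ht' : (0 : ℝ) < t := by exact_mod_cast ht
  have h₂ : 0 ≤ ∑ i, w i := Finset.sum_nonneg fun i _ => h.nonneg i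
  have h₃ : 0 < leverage V H p := by
    by_contra hn
    have := mul_nonpos_of_nonneg_of_nonpos h₂ (not_lt.1 hn)
    linarith
  rw [div_le_iff₀ hW]
  nlinarith

theorem deflate (h : IsDeflated V w H (t + 1)) {p : β} (hp : leverage V H p ≠ 0) :
    IsDeflated V w (deflate H (V p) (leverage V H p)) t := by
  set d := leverage V H p with hd
  set u := H *ᵥ V p with hu
  have hAu : H *ᵥ (moment V w *ᵥ u) = u := by
    rw [hu, mulVec_mulVec, mulVec_mulVec, h.mul_mul]
  have hVu : V p ⬝ᵥ u = d := rfl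
  have huAu : u ⬝ᵥ (moment V w *ᵥ u) = d := by
    nth_rewrite 1 [hu]
    rw [← vecMul_eq_mulVec h.isSymm, ← dotProduct_mulVec, hAu, hVu]
  have hHA : H * moment V w * vecMulVec u u = vecMulVec u u := by
    rw [mul_vecMulVec, ← mulVec_mulVec, hAu]
  have hAH : vecMulVec u u * moment V w * H = vecMulVec u u := by
    have := congrArg Matrix.transpose hHA
    rwa [transpose_mul, transpose_mul, transpose_vecMulVec, h.isSymm, isSymm_moment,
      ← Matrix.mul_assoc] at this
  have hvv : vecMulVec u u * moment V w * vecMulVec u u = d • vecMulVec u u := by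
    rw [Matrix.mul_assoc, mul_vecMulVec, vecMulVec_mul_vecMulVec, huAu]
    ext a b
    simp only [Matrix.smul_apply, vecMulVec_apply, smul_eq_mul, Pi.smul_apply]
    ring
  refine ⟨h.nonneg, isSymm_deflate h.isSymm _ _, ?_, ?_⟩
  · have hdef : OneSided.deflate H (V p) d = H - d⁻¹ • vecMulVec u u := rfl
    rw [hdef]
    simp only [Matrix.sub_mul, Matrix.mul_sub, Matrix.smul_mul, Matrix.mul_smul, hHA, hAH, hvv,
      h.mul_mul, smul_smul, inv_mul_cancel₀ hp, one_smul]
    rw [sub_self, smul_zero, sub_zero]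
  · have h₁ : ∑ i, w i * (V i ⬝ᵥ u) ^ 2 = d := by
      rw [← huAu]
      simp only [dotProduct, mulVec, moment_apply, Finset.mul_sum, Finset.sum_mul, sq]
      rw [Finset.sum_comm]
      refine Finset.sum_congr rfl fun a _ => ?_
      rw [Finset.sum_comm]
      exact Finset.sum_congr rfl fun b _ => Finset.sum_congr rfl fun i _ => by ring
    have h₂ : ∑ i, w i * leverage V (OneSided.deflate H (V p) d) i =
        ∑ i, w i * leverage V H i - (∑ i, w i * (V i ⬝ᵥ u) ^ 2) / d := by
      rw [Finset.sum_div, ← Finset.sum_sub_distrib]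
      refine Finset.sum_congr rfl fun i _ => ?_
      rw [leverage_deflate]
      ring
    rw [h₂, h₁, h.sum_eq, div_self hp]
    simp

end IsDeflated

/-- The Gram matrix, with respect to `H`, of the rows `S` of `V`. -/
def gram (V : Matrix β γ ℝ) (H : Matrix γ γ ℝ) {t : ℕ} (S : Fin t → β) :
    Matrix (Fin t) (Fin t) ℝ :=
  V.submatrix S id * H * (V.submatrix S id)ᵀ

theorem gram_apply (V : Matrix β γ ℝ) (H : Matrix γ γ ℝ) {t : ℕ} (S : Fin t → β) (i j : Fin t) :
    gram V H S i j = V (S i) ⬝ᵥ (H *ᵥ V (S j)) := by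
  rw [gram, Matrix.mul_assoc]
  simp [Matrix.mul_apply, dotProduct, mulVec]

theorem dotProduct_mulVec_symm {H : Matrix γ γ ℝ} (hH : Hᵀ = H) (x y : γ → ℝ) :
    x ⬝ᵥ (H *ᵥ y) = y ⬝ᵥ (H *ᵥ x) := by
  rw [dotProduct_mulVec, vecMul_eq_mulVec hH, dotProduct_comm]

/-- Deflation by a row is the elimination of this row from the Gram determinant. -/
theorem det_gram_cons {V : Matrix β γ ℝ} {H : Matrix γ γ ℝ} (hH : Hᵀ = H) {t : ℕ} {p : β}
    (hp : leverage V H p ≠ 0) (S : Fin t → β) :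
    (gram V H (Fin.cons p S : Fin (t + 1) → β)).det =
      leverage V H p * (gram V (deflate H (V p) (leverage V H p)) S).det := by
  let e : Unit ⊕ Fin t ≃ Fin (t + 1) :=
    (Equiv.sumComm _ _).trans ((Equiv.optionEquivSumPUnit _).symm.trans (finSuccEquiv t).symm)
  have hel : e (Sum.inl ()) = 0 := by simp [e]
  have her : ∀ i, e (Sum.inr i) = Fin.succ i := fun i => by simp [e]
  rw [← det_submatrix_equiv_self e]
  let A : Matrix Unit Unit ℝ := Matrix.of fun _ _ => leverage V H p
  let x : Fin t → ℝ := fun i => V (S i) ⬝ᵥ (H *ᵥ V p)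
  have hblocks : (gram V H (Fin.cons p S : Fin (t + 1) → β)).submatrix e e =
      fromBlocks A (replicateRow Unit x) (replicateCol Unit x) (gram V H S) := by
    ext (i | i) (j | j)
    · rw [submatrix_apply, gram_apply, hel]
      rfl
    · simp only [submatrix_apply, gram_apply, hel, her, Fin.cons_zero, Fin.cons_succ,
        fromBlocks_apply₁₂, replicateRow_apply, x]
      exact dotProduct_mulVec_symm hH _ _
    · simp [gram_apply, hel, her, x]
    · simp [gram_apply, her]
  let B : Matrix Unit Unit ℝ := Matrix.of fun _ _ => (leverage V H p)⁻¹
  have hA : A * B = 1 := by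
    ext i j
    simp [Matrix.mul_apply, A, B, hp]
  let _ : Invertible A := invertibleOfRightInverse _ _ hA
  rw [hblocks, det_fromBlocks₁₁]
  have hinv : ⅟A = B := rfl
  congr 1
  · simp [A, det_unique]
  · congr 1
    ext i j
    rw [Matrix.sub_apply, Matrix.mul_apply, gram_apply, gram_apply, hinv]
    simp only [Matrix.mul_apply, Finset.univ_unique, Finset.sum_singleton, replicateCol_apply,
      replicateRow_apply, x, B, of_apply, deflate, sub_mulVec, dotProduct_sub, smul_mulVec, vecMulVec_mulVec,
      dotProduct_smul, smul_eq_mul]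
    rw [dotProduct_comm (H *ᵥ V p) (V (S j))]
    simp
    ring

end Greedy

/-! ### Column operations -/

section Pivot

variable {β γ : Type} [Fintype β] [Fintype γ] [DecidableEq β] [DecidableEq γ]

/-- The column operations that make row `i` equal to the unit row at column `c`. -/
noncomputable def pivot (E : Matrix β γ ℝ) (i : β) (c : γ) : Matrix β γ ℝ :=
  fun j c' => if c' = c then E j c / E i c else E j c' - E j c / E i c * E i c'

/-- The inverse of the column operations of a pivot step. -/
def unpivot (E : Matrix β γ ℝ) (i : β) (c : γ) : Matrix γ γ ℝ :=
  1 + vecMulVec (Pi.single c 1) (E i - Pi.single c 1)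

theorem pivot_row (E : Matrix β γ ℝ) {i : β} {c : γ} (h : E i c ≠ 0) (c' : γ) :
    pivot E i c i c' = if c' = c then 1 else 0 := by
  simp only [pivot, div_self h]
  split_ifs <;> ring

theorem pivot_of_eq_zero (E : Matrix β γ ℝ) {i j : β} {c : γ} (h : E j c = 0) (c' : γ) :
    pivot E i c j c' = E j c' := by
  simp only [pivot, h]
  split_ifs with hc
  · simp [hc, h]
  · simp

theorem pivot_mul_unpivot (E : Matrix β γ ℝ) {i : β} {c : γ} (h : E i c ≠ 0) :
    pivot E i c * unpivot E i c = E := by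
  ext j c'
  rw [unpivot, Matrix.mul_add, Matrix.mul_one, mul_vecMulVec, Matrix.add_apply, vecMulVec_apply]
  simp only [mulVec_single_one, Pi.sub_apply, col_apply]
  simp only [pivot, if_true]
  split_ifs with hc
  · subst hc
    simp
    field_simp
    ring
  · simp [Pi.single_eq_of_ne hc]

theorem pivot_eq_mul (E : Matrix β γ ℝ) {i : β} {c : γ} (h : E i c ≠ 0) :
    pivot E i c = E * (1 - vecMulVec (Pi.single c 1) ((E i c)⁻¹ • (E i - Pi.single c 1))) := by
  ext j c'
  rw [Matrix.mul_sub, Matrix.mul_one, mul_vecMulVec, Matrix.sub_apply, vecMulVec_apply]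
  simp only [mulVec_single_one, Pi.sub_apply, col_apply, Pi.smul_apply, smul_eq_mul]
  simp only [pivot]
  split_ifs with hc
  · subst hc
    simp
    field_simp
    ring
  · simp [Pi.single_eq_of_ne hc]
    ring

/-- The matrix `E` is obtained from `M` by invertible column operations, and for every column `c`
with a pivot row `ρ c` this row of `E` is the unit row at `c`. -/
structure IsReduction (M E : Matrix β γ ℝ) (ρ : γ → Option β) : Prop where
  exists_eq_mul : ∃ R : Matrix γ γ ℝ, M = E * R
  exists_mul_eq : ∃ Q : Matrix γ γ ℝ, E = M * Q
  row : ∀ c i, ρ c = some i → ∀ c', E i c' = if c' = c then 1 else 0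

theorem IsReduction.refl (M : Matrix β γ ℝ) : IsReduction M M fun _ => none :=
  ⟨⟨1, (Matrix.mul_one M).symm⟩, ⟨1, (Matrix.mul_one M).symm⟩, by simp⟩

theorem IsReduction.pivot {M E : Matrix β γ ℝ} {ρ : γ → Option β} (h : IsReduction M E ρ) {i : β}
    {c : γ} (hc : ρ c = none) (hi : E i c ≠ 0) :
    IsReduction M (pivot E i c) (Function.update ρ c (some i)) := by
  obtain ⟨⟨R, hR⟩, ⟨Q, hQ⟩, hrow⟩ := h
  refine ⟨⟨unpivot E i c * R, ?_⟩, ⟨Q * (1 - vecMulVec (Pi.single c 1)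
    ((E i c)⁻¹ • (E i - Pi.single c 1))), ?_⟩, fun c₁ j hj c' => ?_⟩
  · rw [← Matrix.mul_assoc, pivot_mul_unpivot E hi, hR]
  · rw [pivot_eq_mul E hi, ← Matrix.mul_assoc, ← hQ]
  · rcases eq_or_ne c₁ c with rfl | hne
    · simp only [Function.update_self, Option.some.injEq] at hj
      subst hj
      exact pivot_row E hi c'
    · rw [Function.update_of_ne hne] at hj
      rw [pivot_of_eq_zero, hrow _ _ hj]
      rw [hrow _ _ hj, if_neg]
      rintro rfl
      rw [hc] at hj
      cases hj

/-- `F` expresses the rows of `V` by the rows with the indices `ρ`. -/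
structure IsInterpolation (V F : Matrix β γ ℝ) (ρ : γ → β) : Prop where
  eq_mul : V = F * V.submatrix ρ id
  row : F.submatrix ρ id = 1

theorem isInterpolation_pivot {V F : Matrix β γ ℝ} {ρ : γ → β} (h : IsInterpolation V F ρ) {i : β}
    {a : γ} (hi : F i a ≠ 0) :
    IsInterpolation V (pivot F i a) (Function.update ρ a i) ∧
      (V.submatrix (Function.update ρ a i) id).det = F i a * (V.submatrix ρ id).det := by
  have hrow : ∀ b c, F (ρ b) c = if c = b then 1 else 0 := fun b c => by
    have := congrFun (congrFun h.row b) c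
    simpa [Matrix.one_apply, eq_comm] using this
  have hsub : V.submatrix (Function.update ρ a i) id = unpivot F i a * V.submatrix ρ id := by
    ext b c
    rw [unpivot, Matrix.add_mul, Matrix.one_mul, vecMulVec_mul, Matrix.add_apply, vecMulVec_apply,
      sub_vecMul, Pi.sub_apply]
    rcases eq_or_ne b a with rfl | hb
    · have : (F i ᵥ* V.submatrix ρ id) c = V i c := by
        conv_rhs => rw [h.eq_mul]
        rfl
      simp [this]
    · simp [hb]
  refine ⟨⟨?_, ?_⟩, ?_⟩
  · rw [hsub, ← Matrix.mul_assoc, pivot_mul_unpivot F hi, ← h.eq_mul]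
  · ext b c
    rw [submatrix_apply, id, Matrix.one_apply]
    rcases eq_or_ne b a with rfl | hb
    · rw [Function.update_self, pivot_row F hi]
      simp [eq_comm]
    · rw [Function.update_of_ne hb, pivot_of_eq_zero, hrow]
      · simp [eq_comm]
      · rw [hrow, if_neg (Ne.symm hb)]
  · rw [hsub, det_mul, unpivot, vecMulVec_eq Unit, det_one_add_replicateCol_mul_replicateRow]
    simp

end Pivot

/-! ### Elimination and exchange programs -/

section Programs

variable {ι β γ : Type} [Fintype β] [Fintype γ] [DecidableEq β] [DecidableEq γ]
  {inp : ι → ℝ} {mem : List ℝ}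

/-- The operands `E` stand for the entries of the matrix `X`. -/
def DenotesMat (inp : ι → ℝ) (mem : List ℝ) (E : β → γ → Operand ι) (X : Matrix β γ ℝ) : Prop :=
  ∀ i j, Denotes inp mem (E i j) (X i j)

theorem DenotesMat.mono {mem' : List ℝ} {E : β → γ → Operand ι} {X : Matrix β γ ℝ}
    (h : DenotesMat inp mem E X) (hle : mem <+: mem') : DenotesMat inp mem' E X :=
  fun i j => (h i j).mono hle

/-- Computes the entries of a matrix one by one. -/
noncomputable def tabMat (f : β → γ → Code ι (Operand ι)) : Code ι (β → γ → Operand ι) := do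
  let g ← tab fun e : β × γ => f e.1 e.2
  pure fun i j => g (i, j)

theorem runs_tabMat {f : β → γ → Code ι (Operand ι)} {N K : ℕ} {X : Matrix β γ ℝ}
    (hK : Fintype.card β * Fintype.card γ * N ≤ K)
    (hf : ∀ i j mem', mem <+: mem' →
      Runs inp mem' (f i j) N (fun u m => Denotes inp m u (X i j))) :
    Runs inp mem (tabMat f) K (fun E mem' => DenotesMat inp mem' E X) := by
  refine Runs.bind (runs_tab (N := N) (K := K) (x := fun e : β × γ => X e.1 e.2)
    (by simpa using hK) fun e mem' h => hf _ _ _ h) (N' := 0) le_rfl fun g mem₁ _ hg => ?_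
  exact Runs.pure fun i j => hg (i, j)

/-- Tests whether a number is nonzero. -/
def testNeZero (u : Operand ι) : Code ι Bool := do
  let a ← test u (.const 0)
  let b ← test (.const 0) u
  pure (!(a && b))

theorem runs_testNeZero {u : Operand ι} {x : ℝ} (hu : Denotes inp mem u x) :
    Runs inp mem (testNeZero u) 2 (fun b _ => b = true ↔ x ≠ 0) := by
  refine Runs.bind (runs_test hu (denotes_const 0)) (N' := 1) le_rfl fun a mem₁ h₁ ha => ?_
  refine Runs.bind (runs_test (denotes_const 0) (hu.mono h₁)) (N' := 0) le_rfl
    fun b mem₂ h₂ hb => ?_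
  refine Runs.pure ?_
  rw [Rat.cast_zero] at ha hb
  rw [Bool.not_eq_true', ← Bool.not_eq_true, Bool.and_eq_true, ha, hb, ← le_antisymm_iff]

/-- Tests whether the absolute value of a number exceeds two. -/
def testTwoLt (u : Operand ι) : Code ι Bool := do
  let a ← test u (.const 2)
  let b ← test (.const (-2)) u
  pure (!(a && b))

theorem runs_testTwoLt {u : Operand ι} {x : ℝ} (hu : Denotes inp mem u x) :
    Runs inp mem (testTwoLt u) 2 (fun b _ => b = true ↔ 2 < |x|) := by
  refine Runs.bind (runs_test hu (denotes_const 2)) (N' := 1) le_rfl fun a mem₁ h₁ ha => ?_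
  refine Runs.bind (runs_test (denotes_const (-2)) (hu.mono h₁)) (N' := 0) le_rfl
    fun b mem₂ h₂ hb => ?_
  refine Runs.pure ?_
  push_cast at ha hb
  rw [Bool.not_eq_true', ← Bool.not_eq_true, Bool.and_eq_true, ha, hb, ← not_le, abs_le, and_comm]

/-- The column operations of a pivot step. -/
noncomputable def pivotCode (E : β → γ → Operand ι) (i : β) (c : γ) :
    Code ι (β → γ → Operand ι) := do
  let q ← tab fun j => arith .div (E j c) (E i c)
  tabMat fun j c' =>
    if c' = c then pure (q j)
    else do
      let t ← arith .mul (q j) (E i c')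
      arith .sub (E j c') t

theorem runs_pivotCode {E : β → γ → Operand ι} {X : Matrix β γ ℝ} (hE : DenotesMat inp mem E X)
    (i : β) (c : γ) :
    Runs inp mem (pivotCode E i c) (3 * (Fintype.card β * Fintype.card γ))
      (fun E' m => DenotesMat inp m E' (pivot X i c)) := by
  have hγ : 0 < Fintype.card γ := Fintype.card_pos_iff.2 ⟨c⟩
  have hle := Nat.mul_le_mul_left (Fintype.card β) hγ
  refine Runs.bind (runs_tab (N := 1) (K := Fintype.card β) (x := fun j => X j c / X i c) (by simp)
    fun j m h => runs_arith ((hE j c).mono h) ((hE i c).mono h))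
    (N' := 2 * (Fintype.card β * Fintype.card γ)) (by linarith) fun q mem₁ h₁ hq => ?_
  refine runs_tabMat (N := 2) (by linarith) fun j c' m h => ?_
  by_cases hc : c' = c
  · rw [if_pos hc]
    refine Runs.pure ?_
    rw [pivot, if_pos hc]
    exact (hq j).mono h
  · rw [if_neg hc]
    refine Runs.bind (runs_arith ((hq j).mono h) ((hE i c').mono (h₁.trans h))) (N' := 1) le_rfl
      fun t m' h' ht => ?_
    rw [pivot, if_neg hc]
    exact runs_arith ((hE j c').mono (h₁.trans (h.trans h'))) ht

/-- Gauss–Jordan elimination by column operations. The rows are visited in the given order, and a row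
becomes the pivot row of a column if it has a nonzero entry in a column without a pivot row. -/
noncomputable def eliminate : List β → (β → γ → Operand ι) → (γ → Option β) →
    Code ι ((β → γ → Operand ι) × (γ → Option β))
  | [], E, ρ => pure (E, ρ)
  | i :: l, E, ρ => do
    let c ← findCode (fun c => testNeZero (E i c)) {c | ρ c = none}.toFinset.toList
    match c with
    | none => eliminate l E ρ
    | some c => do
      let E' ← pivotCode E i c
      eliminate l E' (Function.update ρ c (some i))

theorem runs_eliminate {M X : Matrix β γ ℝ} (l : List β) {E : β → γ → Operand ι}
    {ρ : γ → Option β} (hE : DenotesMat inp mem E X) (hX : IsReduction M X ρ) :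
    Runs inp mem (eliminate l E ρ)
      (l.length * (2 * Fintype.card γ) +
        {c | ρ c = none}.toFinset.card * (3 * (Fintype.card β * Fintype.card γ)))
      (fun out m => ∃ X', DenotesMat inp m out.1 X' ∧ IsReduction M X' out.2 ∧
        (∀ i, (i ∈ l ∨ ∀ c, ρ c = none → X i c = 0) → ∀ c, out.2 c = none → X' i c = 0) ∧
        ∀ c i, out.2 c = some i → ρ c = some i ∨ i ∈ l) := by
  induction l generalizing mem E X ρ with
  | nil => exact Runs.pure ⟨X, hE, hX, by simp, by simp⟩
  | cons i l ih =>
    have hlen : {c | ρ c = none}.toFinset.toList.length ≤ Fintype.card γ := by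
      rw [Finset.length_toList]
      exact Finset.card_le_univ _
    refine Runs.bind ((runs_findCode _ fun c _ m h => runs_testNeZero ((hE i c).mono h)).mono
      (Nat.mul_le_mul_right 2 hlen)) (N' := l.length * (2 * Fintype.card γ) +
        {c | ρ c = none}.toFinset.card * (3 * (Fintype.card β * Fintype.card γ)))
      (by simp only [List.length_cons]; ring_nf; rfl) ?_
    rintro (_ | c) mem₁ h₁ ⟨hnone, hsome⟩
    · refine (ih (hE.mono h₁) hX).weaken le_rfl ?_
      rintro out m _ ⟨X', hE', hX', hz, hs⟩
      refine ⟨X', hE', hX', fun j hj => hz j ?_, fun c j h => ?_⟩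
      · rcases hj with hj | hj
        · rcases List.mem_cons.1 hj with rfl | hj
          · refine Or.inr fun c hc => not_not.1 (hnone rfl c (by simpa using hc))
          · exact Or.inl hj
        · exact Or.inr hj
      · rcases hs c j h with h | h
        · exact Or.inl h
        · exact Or.inr (List.mem_cons_of_mem _ h)
    · obtain ⟨hc, hne⟩ := hsome c rfl
      replace hc : ρ c = none := by simpa using hc
      have hcard : {c' | Function.update ρ c (some i) c' = none}.toFinset.card + 1 =
          {c | ρ c = none}.toFinset.card := by
        have : {c' | Function.update ρ c (some i) c' = none}.toFinset =
            {c | ρ c = none}.toFinset.erase c := by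
          ext c'
          rcases eq_or_ne c' c with rfl | h
          · simp
          · simp [h]
        rw [this, Finset.card_erase_add_one (by simpa using hc)]
      simp only
      refine Runs.bind (runs_pivotCode (hE.mono h₁) i c) (N' := l.length * (2 * Fintype.card γ) +
        {c' | Function.update ρ c (some i) c' = none}.toFinset.card *
          (3 * (Fintype.card β * Fintype.card γ))) ?_ fun E' mem₂ h₂ hE' => ?_
      · rw [← hcard]
        ring_nf
        rfl
      refine (ih hE' (hX.pivot hc hne)).weaken le_rfl ?_
      rintro out m _ ⟨X', hE'', hX', hz, hs⟩
      have hnew : ∀ j, (∀ c', ρ c' = none → X j c' = 0) →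
          ∀ c', Function.update ρ c (some i) c' = none → pivot X i c j c' = 0 := by
        intro j hj c' hc'
        rw [pivot_of_eq_zero _ (hj c hc)]
        refine hj c' ?_
        rcases eq_or_ne c' c with rfl | h
        · simp at hc'
        · rwa [Function.update_of_ne h] at hc'
      refine ⟨X', hE'', hX', fun j hj => hz j ?_, fun c' j h => ?_⟩
      · rcases hj with hj | hj
        · rcases List.mem_cons.1 hj with rfl | hj
          · refine Or.inr fun c' hc' => ?_
            rw [pivot_row _ hne, if_neg]
            rintro rfl
            simp at hc'
          · exact Or.inl hj
        · exact Or.inr (hnew j hj)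
      · rcases hs c' j h with h | h
        · rcases eq_or_ne c' c with rfl | hcc
          · simp only [Function.update_self, Option.some.injEq] at h
            exact Or.inr (by simp [h])
          · exact Or.inl (by rwa [Function.update_of_ne hcc] at h)
        · exact Or.inr (List.mem_cons_of_mem _ h)

/-- At most `N` exchanges of a row of the basis for a row which has an entry larger than two. -/
noncomputable def exchange : ℕ → (β → γ → Operand ι) → (γ → β) →
    Code ι ((β → γ → Operand ι) × (γ → β))
  | 0, F, ρ => pure (F, ρ)
  | N + 1, F, ρ => do
    let e ← findCode (fun e : β × γ => testTwoLt (F e.1 e.2)) Finset.univ.toList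
    match e with
    | none => pure (F, ρ)
    | some e => do
      let F' ← pivotCode F e.1 e.2
      exchange N F' (Function.update ρ e.2 e.1)

/-- Every exchange doubles the determinant of the basis, hence at most `N` of them are possible if
the square of this determinant is at least `D / 4 ^ N`, where `D` bounds the squares of all
determinants. -/
theorem runs_exchange {V X : Matrix β γ ℝ} {D : ℝ} (hD : 0 < D)
    (hmax : ∀ ρ : γ → β, (V.submatrix ρ id).det ^ 2 ≤ D) (N : ℕ) {F : β → γ → Operand ι}
    {ρ : γ → β} (hF : DenotesMat inp mem F X) (hX : IsInterpolation V X ρ)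
    (hN : D ≤ 4 ^ N * (V.submatrix ρ id).det ^ 2) :
    Runs inp mem (exchange N F ρ) (N * (5 * (Fintype.card β * Fintype.card γ)))
      (fun out m => ∃ X', DenotesMat inp m out.1 X' ∧ IsInterpolation V X' out.2 ∧
        ∀ i a, |X' i a| ≤ 2) := by
  have hgrow : ∀ {X : Matrix β γ ℝ} {ρ : γ → β} {i a} (N : ℕ), IsInterpolation V X ρ →
      2 < |X i a| → D ≤ 4 ^ N * (V.submatrix ρ id).det ^ 2 →
      4 * D < 4 ^ N * (V.submatrix (Function.update ρ a i) id).det ^ 2 := by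
    intro X ρ i a N hX h hN
    have hne : X i a ≠ 0 := fun h0 => by
      rw [h0, abs_zero] at h
      linarith
    rw [(isInterpolation_pivot hX hne).2, mul_pow]
    have h4 : 4 < X i a ^ 2 := by
      rw [← sq_abs]
      nlinarith
    have hpos : 0 < (4 : ℝ) ^ N * (V.submatrix ρ id).det ^ 2 := hD.trans_le hN
    nlinarith
  induction N generalizing mem F X ρ with
  | zero =>
    refine Runs.pure ⟨X, hF, hX, fun i a => not_lt.1 fun h => ?_⟩
    have h₁ := hgrow 0 hX h hN
    have h₂ := hmax (Function.update ρ a i)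
    rw [pow_zero, one_mul] at h₁
    linarith
  | succ N ih =>
    have hlen : (Finset.univ : Finset (β × γ)).toList.length = Fintype.card β * Fintype.card γ := by
      simp
    refine Runs.bind ((runs_findCode _ fun (e : β × γ) _ m h =>
      runs_testTwoLt ((hF e.1 e.2).mono h)).mono (Nat.mul_le_mul_right 2 hlen.le))
      (N' := 3 * (Fintype.card β * Fintype.card γ) + N * (5 * (Fintype.card β * Fintype.card γ)))
      (by ring_nf; rfl) ?_
    rintro (_ | e) mem₁ h₁ ⟨hnone, hsome⟩
    · exact Runs.pure ⟨X, hF.mono h₁, hX, fun i a => not_lt.1 (hnone rfl (i, a) (by simp))⟩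
    · have he := (hsome e rfl).2
      have hne : X e.1 e.2 ≠ 0 := fun h0 => by
        rw [h0, abs_zero] at he
        linarith
      refine Runs.bind (runs_pivotCode (hF.mono h₁) e.1 e.2) le_rfl fun F' mem₂ h₂ hF' => ?_
      refine ih hF' (isInterpolation_pivot hX hne).1 ?_
      have := hgrow (N + 1) hX he hN
      rw [pow_succ] at this
      linarith

end Programs

/-! ### Programs for leverages and for greedy selection -/

section Leverage

variable {ι β γ : Type} [Fintype β] [Fintype γ] [DecidableEq β] [DecidableEq γ]
  {inp : ι → ℝ} {mem : List ℝ}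

/-- The inner product of two vectors. -/
noncomputable def dotCode (u v : γ → Operand ι) : Code ι (Operand ι) :=
  sumCode Finset.univ fun a => arith .mul (u a) (v a)

theorem runs_dotCode {u v : γ → Operand ι} {x y : γ → ℝ} (hu : ∀ a, Denotes inp mem (u a) (x a))
    (hv : ∀ a, Denotes inp mem (v a) (y a)) :
    Runs inp mem (dotCode u v) (2 * Fintype.card γ) (fun w m => Denotes inp m w (x ⬝ᵥ y)) :=
  runs_sumCode (N := 1) (by rw [Finset.card_univ, mul_comm]) fun a _ h =>
    runs_arith ((hu a).mono h) ((hv a).mono h)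

/-- The product of a matrix and a vector. -/
noncomputable def mulVecCode (H : β → γ → Operand ι) (v : γ → Operand ι) :
    Code ι (β → Operand ι) :=
  tab fun a => dotCode (H a) v

theorem runs_mulVecCode {H : β → γ → Operand ι} {v : γ → Operand ι} {X : Matrix β γ ℝ} {x : γ → ℝ}
    (hH : DenotesMat inp mem H X) (hv : ∀ a, Denotes inp mem (v a) (x a)) :
    Runs inp mem (mulVecCode H v) (2 * (Fintype.card β * Fintype.card γ))
      (fun u m => ∀ a, Denotes inp m (u a) ((X *ᵥ x) a)) :=
  runs_tab (N := 2 * Fintype.card γ) (by ring_nf; rfl) fun a _ h =>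
    runs_dotCode (fun b => (hH a b).mono h) fun b => (hv b).mono h

/-- The leverage of the vector `v`. -/
noncomputable def leverageCode (H : γ → γ → Operand ι) (v : γ → Operand ι) :
    Code ι (Operand ι) := do
  let u ← mulVecCode H v
  dotCode v u

theorem runs_leverageCode {H : γ → γ → Operand ι} {Vo : β → γ → Operand ι} {X : Matrix γ γ ℝ}
    {V : Matrix β γ ℝ} (hH : DenotesMat inp mem H X) (hV : DenotesMat inp mem Vo V) (i : β) :
    Runs inp mem (leverageCode H (Vo i)) (4 * Fintype.card γ ^ 2)
      (fun u m => Denotes inp m u (leverage V X i)) := by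
  have hk : Fintype.card γ ≤ Fintype.card γ ^ 2 := Nat.le_self_pow two_ne_zero _
  refine Runs.bind (runs_mulVecCode hH (hV i)) (N' := 2 * Fintype.card γ) (by nlinarith)
    fun u mem₁ h₁ hu => ?_
  exact runs_dotCode (fun a => (hV i a).mono h₁) hu

/-- The rank one modification `H - u uᵀ / d`. -/
noncomputable def deflateCode (H : γ → γ → Operand ι) (u : γ → Operand ι) (d : Operand ι) :
    Code ι (γ → γ → Operand ι) :=
  tabMat fun a b => do
    let s ← arith .mul (u a) (u b)
    let t ← arith .div s d
    arith .sub (H a b) t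

theorem runs_deflateCode {H : γ → γ → Operand ι} {u : γ → Operand ι} {d : Operand ι}
    {X : Matrix γ γ ℝ} {v : γ → ℝ} {e : ℝ} (hH : DenotesMat inp mem H X)
    (hu : ∀ a, Denotes inp mem (u a) ((X *ᵥ v) a)) (hd : Denotes inp mem d e) :
    Runs inp mem (deflateCode H u d) (3 * Fintype.card γ ^ 2)
      (fun H' m => DenotesMat inp m H' (deflate X v e)) := by
  refine runs_tabMat (N := 3) (by ring_nf; rfl) fun a b m h => ?_
  refine Runs.bind (runs_arith ((hu a).mono h) ((hu b).mono h)) (N' := 2) le_rfl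
    fun s m₁ h₁ hs => ?_
  refine Runs.bind (runs_arith hs (hd.mono (h.trans h₁))) (N' := 1) le_rfl fun t m₂ h₂ ht => ?_
  refine (runs_arith ((hH a b).mono (h.trans (h₁.trans h₂))) ht).weaken le_rfl fun w m _ hw => ?_
  have : deflate X v e a b = X a b - (X *ᵥ v) a * (X *ᵥ v) b / e := by
    simp only [deflate, Matrix.sub_apply, Matrix.smul_apply, vecMulVec_apply, smul_eq_mul]
    ring
  rw [this]
  exact hw

/-- Greedy selection of `t` rows of `V`: every row selected has the largest leverage, and is then
deflated. The operands `lev` are the leverages with respect to `H`, and the maximum is searched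
starting from the row `p₀`. -/
noncomputable def greedy (p₀ : β) (Vo : β → γ → Operand ι) :
    (t : ℕ) → (γ → γ → Operand ι) → (β → Operand ι) → Code ι (Fin t → β)
  | 0, _, _ => pure Fin.elim0
  | t + 1, H, lev => do
    let p ← argmax lev p₀ Finset.univ.toList
    let u ← mulVecCode H (Vo p)
    let y ← mulVecCode Vo u
    let H' ← deflateCode H u (lev p)
    let lev' ← tab fun i => do
      let s ← arith .mul (y i) (y i)
      let q ← arith .div s (lev p)
      arith .sub (lev i) q
    let S ← greedy p₀ Vo t H' lev'
    pure (Fin.cons p S)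

/-- The largest leverage is at least `(t + 1) / W` when `t + 1` rows remain to be selected, and the
determinant of the Gram matrix is the product of the leverages of the selected rows. -/
theorem runs_greedy {p₀ : β} {Vo : β → γ → Operand ι} {V : Matrix β γ ℝ} {w : β → ℝ} {W : ℝ}
    (hW : 0 < W) (hw : ∑ i, w i ≤ W) (t : ℕ) {H : γ → γ → Operand ι} {X : Matrix γ γ ℝ}
    {lev : β → Operand ι} (hV : DenotesMat inp mem Vo V) (hH : DenotesMat inp mem H X)
    (hlev : ∀ i, Denotes inp mem (lev i) (leverage V X i)) (hX : IsDeflated V w X t) :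
    Runs inp mem (greedy p₀ Vo t H lev)
      (t * (4 * Fintype.card β + 2 * (Fintype.card β * Fintype.card γ) + 5 * Fintype.card γ ^ 2))
      (fun S _ => (t.factorial : ℝ) / W ^ t ≤ (gram V X S).det) := by
  induction t generalizing mem H X lev with
  | zero => exact Runs.pure (by simp)
  | succ t ih =>
    set m := Fintype.card β
    set k := Fintype.card γ
    set N := t * (4 * m + 2 * (m * k) + 5 * k ^ 2) with hN
    refine Runs.bind (runs_argmax (x := leverage V X) p₀ Finset.univ.toList fun i _ => hlev i)
      (N' := 3 * m + 2 * (m * k) + 5 * k ^ 2 + N) ?_ ?_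
    · simp only [Finset.length_toList, Finset.card_univ, hN, m, k]
      ring_nf
      rfl
    rintro p mem₁ h₁ ⟨-, hp⟩
    replace hp : ∀ i, leverage V X i ≤ leverage V X p := fun i => hp i (by simp)
    have hle := hX.le_leverage hW hw hp (Nat.succ_pos t)
    have hpos : 0 < leverage V X p := lt_of_lt_of_le (by positivity) hle
    refine Runs.bind (runs_mulVecCode (hH.mono h₁) fun a => (hV p a).mono h₁)
      (N' := 3 * m + 2 * (m * k) + 3 * k ^ 2 + N) (by simp only [m, k]; ring_nf; rfl) fun u mem₂ h₂ hu => ?_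
    replace h₂ := h₁.trans h₂
    refine Runs.bind (runs_mulVecCode (hV.mono h₂) hu) (N' := 3 * m + 3 * k ^ 2 + N)
      (by simp only [m, k]; ring_nf; rfl) fun y mem₃ h₃ hy => ?_
    replace hu := fun a => (hu a).mono h₃
    replace h₃ := h₂.trans h₃
    refine Runs.bind (runs_deflateCode (hH.mono h₃) hu ((hlev p).mono h₃))
      (N' := 3 * m + N) (by simp only [m, k]; ring_nf; rfl) fun H' mem₄ h₄ hH' => ?_
    replace hy := fun a => (hy a).mono h₄
    replace h₄ := h₃.trans h₄
    refine Runs.bind (runs_tab (N := 3) (K := 3 * m)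
      (x := leverage V (deflate X (V p) (leverage V X p))) (by rw [mul_comm]) fun i mem' h => ?_)
      (N' := N) le_rfl fun lev' mem₅ h₅ hlev' => ?_
    · refine Runs.bind (runs_arith ((hy i).mono h) ((hy i).mono h)) (N' := 2) le_rfl
        fun s m₁ h₁ hs => ?_
      refine Runs.bind (runs_arith hs ((hlev p).mono (h₄.trans (h.trans h₁)))) (N' := 1) le_rfl
        fun q m₂ h₂ hq => ?_
      refine (runs_arith ((hlev i).mono (h₄.trans (h.trans (h₁.trans h₂)))) hq).weaken le_rfl
        fun w m _ hw => ?_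
      rw [leverage_deflate, sq]
      exact hw
    · refine Runs.bind (ih (hV.mono (h₄.trans h₅)) (hH'.mono h₅) hlev' (hX.deflate hpos.ne'))
        (N' := 0) le_rfl fun S mem₆ h₆ hS => ?_
      refine Runs.pure ?_
      rw [det_gram_cons hX.isSymm hpos.ne', Nat.factorial_succ, pow_succ]
      push_cast at hle ⊢
      calc ((t : ℝ) + 1) * t.factorial / (W ^ t * W)
          = ((t : ℝ) + 1) / W * (t.factorial / W ^ t) := by
            field_simp
        _ ≤ _ := mul_le_mul hle hS (by positivity) hpos.le

end Leverage

/-! ### Computing a design with bounded leverages -/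

section Cover

variable {ι γ : Type} [Fintype γ] [DecidableEq γ] {m : ℕ} {inp : ι → ℝ} {mem : List ℝ}

/-- The weights one on the first `j` rows. -/
def headWeight (m j : ℕ) (i : Fin m) : ℝ := if (i : ℕ) < j then 1 else 0

theorem headWeight_zero : headWeight m 0 = 0 := by
  ext i
  simp [headWeight]

theorem headWeight_succ {n : ℕ} (h : n < m) :
    headWeight m (n + 1) = headWeight m n + Pi.single ⟨n, h⟩ 1 := by
  ext i
  simp only [headWeight, Pi.add_apply, Pi.single_apply, Fin.ext_iff]
  rcases lt_trichotomy (i : ℕ) n with h | h | h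
  · rw [if_pos (by omega), if_pos h, if_neg (by omega), add_zero]
  · rw [if_pos (by omega), if_neg (by omega), if_pos h, zero_add]
  · rw [if_neg (by omega), if_neg (by omega), if_neg (by omega), add_zero]

/-- The sum of the leverages of the rows with indices in `[lo, hi)`. -/
noncomputable def blockLeverage (V : Matrix (Fin m) γ ℝ) (H : Matrix γ γ ℝ) (lo hi : ℕ) : ℝ :=
  ∑ i ∈ {i : Fin m | lo ≤ (i : ℕ) ∧ (i : ℕ) < hi}, leverage V H i

theorem blockLeverage_eq (V : Matrix (Fin m) γ ℝ) (H : Matrix γ γ ℝ) {lo hi : ℕ} (h : lo ≤ hi) :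
    blockLeverage V H lo hi = ∑ e : γ × γ, H e.1 e.2 *
      (moment V (headWeight m hi) e.2 e.1 - moment V (headWeight m lo) e.2 e.1) := by
  have h₁ : ∀ j, ∑ e : γ × γ, H e.1 e.2 * moment V (headWeight m j) e.2 e.1 =
      ∑ i, headWeight m j i * leverage V H i := fun j => by
    rw [sum_mul_leverage, Fintype.sum_prod_type]
    simp [Matrix.trace, Matrix.mul_apply]
  simp only [mul_sub, Finset.sum_sub_distrib, h₁]
  rw [← Finset.sum_sub_distrib, blockLeverage, Finset.sum_filter]
  refine Finset.sum_congr rfl fun i _ => ?_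
  simp only [headWeight]
  rcases lt_or_ge (i : ℕ) lo with h' | h'
  · rw [if_neg (by omega), if_pos (by omega), if_pos h']
    ring
  · rcases lt_or_ge (i : ℕ) hi with h'' | h''
    · rw [if_pos ⟨h', h''⟩, if_pos h'', if_neg (by omega)]
      ring
    · rw [if_neg (by omega), if_neg (by omega), if_neg (by omega)]
      ring

/-- The moment matrices of the first `j` rows, for all `j ≤ n`. -/
noncomputable def prefixMoments (Vo : Fin m → γ → Operand ι) :
    ℕ → Code ι (ℕ → γ → γ → Operand ι)
  | 0 => pure fun _ _ _ => .const 0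
  | n + 1 => do
    let S ← prefixMoments Vo n
    if h : n < m then do
      let T ← tabMat fun a b => do
        let t ← arith .mul (Vo ⟨n, h⟩ a) (Vo ⟨n, h⟩ b)
        arith .add (S n a b) t
      pure fun j => if j = n + 1 then T else S j
    else pure S

theorem runs_prefixMoments {Vo : Fin m → γ → Operand ι} {V : Matrix (Fin m) γ ℝ}
    (hV : DenotesMat inp mem Vo V) (n : ℕ) (hn : n ≤ m) :
    Runs inp mem (prefixMoments Vo n) (n * (2 * Fintype.card γ ^ 2))
      (fun S mem' => ∀ j ≤ n, DenotesMat inp mem' (S j) (moment V (headWeight m j))) := by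
  induction n with
  | zero =>
    refine Runs.pure fun j hj => ?_
    obtain rfl : j = 0 := by omega
    intro a b
    simpa [headWeight_zero, moment_apply] using denotes_const (inp := inp) (mem := mem) (0 : ℚ)
  | succ n ih =>
    refine Runs.bind (ih (by omega)) (N' := 2 * Fintype.card γ ^ 2) (by ring_nf; rfl)
      fun S mem₁ h₁ hS => ?_
    rw [dif_pos (show n < m by omega)]
    refine Runs.bind (runs_tabMat (N := 2) (K := 2 * Fintype.card γ ^ 2)
      (X := moment V (headWeight m (n + 1))) (by ring_nf; rfl) fun a b m' h => ?_) (N' := 0) le_rfl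
      fun T mem₂ h₂ hT => ?_
    · refine Runs.bind (runs_arith ((hV _ a).mono (h₁.trans h)) ((hV _ b).mono (h₁.trans h)))
        (N' := 1) le_rfl fun t m'' h' ht => ?_
      have := runs_arith (o := .add) ((hS n le_rfl a b).mono (h.trans h')) ht
      rw [headWeight_succ (show n < m by omega), moment_add_single]
      simpa [vecMulVec_apply, ArithOp.apply] using this
    · refine Runs.pure fun j hj => ?_
      by_cases h : j = n + 1
      · rw [if_pos h, h]
        exact hT
      · rw [if_neg h]
        exact (hS j (by omega)).mono h₂

/-- The inner product of `H` with the difference of two moment matrices. -/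
noncomputable def blockCode (H Sh Sl : γ → γ → Operand ι) : Code ι (Operand ι) :=
  sumCode (Finset.univ : Finset (γ × γ)) fun e => do
    let t ← arith .sub (Sh e.2 e.1) (Sl e.2 e.1)
    arith .mul (H e.1 e.2) t

theorem runs_blockCode {H Sh Sl : γ → γ → Operand ι} {V : Matrix (Fin m) γ ℝ} {X : Matrix γ γ ℝ}
    {lo hi : ℕ} (h : lo ≤ hi) (hH : DenotesMat inp mem H X)
    (hh : DenotesMat inp mem Sh (moment V (headWeight m hi)))
    (hl : DenotesMat inp mem Sl (moment V (headWeight m lo))) :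
    Runs inp mem (blockCode H Sh Sl) (3 * Fintype.card γ ^ 2)
      (fun u m' => Denotes inp m' u (blockLeverage V X lo hi)) := by
  rw [blockLeverage_eq V X h]
  refine runs_sumCode (N := 2) (by rw [Finset.card_univ, Fintype.card_prod]; ring_nf; rfl)
    fun e m' h' => ?_
  refine Runs.bind (runs_arith ((hh _ _).mono h') ((hl _ _).mono h')) (N' := 1) le_rfl
    fun t m'' h'' ht => ?_
  exact runs_arith ((hH _ _).mono (h'.trans h'')) ht

/-- Adds one to the weight of row `i`. -/
noncomputable def addRow (Vo : Fin m → γ → Operand ι) (H : γ → γ → Operand ι) (i : Fin m) :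
    Code ι (γ → γ → Operand ι) := do
  let u ← mulVecCode H (Vo i)
  let l ← dotCode (Vo i) u
  let d ← arith .add (.const 1) l
  deflateCode H u d

theorem runs_addRow {Vo : Fin m → γ → Operand ι} {V : Matrix (Fin m) γ ℝ} {H : γ → γ → Operand ι}
    {X : Matrix γ γ ℝ} (hV : DenotesMat inp mem Vo V) (hH : DenotesMat inp mem H X)
    [Nonempty γ] (i : Fin m) :
    Runs inp mem (addRow Vo H i) (8 * Fintype.card γ ^ 2)
      (fun H' m' => DenotesMat inp m' H' (deflate X (V i) (1 + leverage V X i))) := by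
  have hk : 0 < Fintype.card γ := Fintype.card_pos
  refine Runs.bind (runs_mulVecCode hH (hV i))
    (N' := 2 * Fintype.card γ + 1 + 3 * Fintype.card γ ^ 2) (by nlinarith) fun u m₁ h₁ hu => ?_
  refine Runs.bind (runs_dotCode (fun a => (hV i a).mono h₁) hu)
    (N' := 1 + 3 * Fintype.card γ ^ 2) (by linarith) fun l m₂ h₂ hl => ?_
  refine Runs.bind (runs_arith (denotes_const 1) hl) le_rfl fun d m₃ h₃ hd => ?_
  refine runs_deflateCode (hH.mono (h₁.trans (h₂.trans h₃)))
    (fun a => (hu a).mono (h₂.trans h₃)) ?_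
  simpa [ArithOp.apply, leverage] using hd

theorem IsDesign.leverage_add_single_le {V : Matrix (Fin m) γ ℝ} {w : Fin m → ℝ} {X : Matrix γ γ ℝ}
    (h : IsDesign V w X) (i j : Fin m) :
    leverage V (deflate X (V i) (1 + leverage V X i)) j ≤ leverage V X j := by
  rw [leverage_deflate]
  have := h.leverage_nonneg i
  have h' : 0 ≤ (V j ⬝ᵥ X *ᵥ V i) ^ 2 / (1 + leverage V X i) := by positivity
  linarith

theorem IsDesign.leverage_add_single_self {V : Matrix (Fin m) γ ℝ} {w : Fin m → ℝ}
    {X : Matrix γ γ ℝ} (h : IsDesign V w X) (i : Fin m) :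
    leverage V (deflate X (V i) (1 + leverage V X i)) i ≤ 1 := by
  rw [leverage_deflate]
  have h₀ := h.leverage_nonneg i
  have h' : V i ⬝ᵥ X *ᵥ V i = leverage V X i := rfl
  rw [h', sub_le_iff_le_add, ← sub_le_iff_le_add', le_div_iff₀ (by positivity)]
  nlinarith

/-- The indices of a block of rows. -/
noncomputable def blockRows (m lo hi : ℕ) : List (Fin m) :=
  Finset.toList {i : Fin m | lo ≤ (i : ℕ) ∧ (i : ℕ) < hi}

theorem card_block_le (m lo b : ℕ) :
    (Finset.card {i : Fin m | lo ≤ (i : ℕ) ∧ (i : ℕ) < min (lo + b) m}) ≤ b := by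
  calc _ = (Finset.map Fin.valEmbedding {i : Fin m | lo ≤ (i : ℕ) ∧ (i : ℕ) < min (lo + b) m}).card
        := (Finset.card_map _).symm
    _ ≤ (Finset.Ico lo (lo + b)).card := by
        refine Finset.card_le_card fun x hx => ?_
        simp only [Finset.mem_map, Finset.mem_filter, Finset.mem_univ, true_and] at hx
        obtain ⟨i, ⟨h₁, h₂⟩, rfl⟩ := hx
        simp only [Fin.valEmbedding_apply, Finset.mem_Ico]
        omega
    _ = b := by simp

/-- Visits blocks of `b` consecutive rows, whose first rows are listed. As long as the leverages of
the rows of a block add up to more than `b`, some row of the block has a leverage larger than one,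
and its weight is increased by one. At most `N` such additions are performed. -/
noncomputable def sweep (Vo : Fin m → γ → Operand ι) (S : ℕ → γ → γ → Operand ι) (b : ℕ) :
    ℕ → List ℕ → (γ → γ → Operand ι) → Code ι (γ → γ → Operand ι)
  | _, [], H => pure H
  | 0, _ :: _, H => pure H
  | N + 1, lo :: l, H => do
    let s ← blockCode H (S (min (lo + b) m)) (S lo)
    let r ← test s (.const b)
    if r then sweep Vo S b (N + 1) l H
    else do
      let i ← findCode (fun i => do
        let x ← leverageCode H (Vo i)
        let r ← test x (.const 1)
        pure (!r)) (blockRows m lo (min (lo + b) m))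
      match i with
      | none => pure H
      | some i => do
        let H' ← addRow Vo H i
        sweep Vo S b N (lo :: l) H'
  termination_by N l _ => (N, l.length)

/-- The number `k * q` of additions is never exhausted, by `IsDesign.not_two_pow_le`; the number `c`
counts the additions made before. -/
theorem runs_sweep [Nonempty γ] {Vo : Fin m → γ → Operand ι} {V : Matrix (Fin m) γ ℝ}
    {S : ℕ → γ → γ → Operand ι} (b : ℕ) {w₀ : Fin m → ℝ} {X₀ : Matrix γ γ ℝ}
    (h₀ : IsDesign V w₀ X₀) {q : ℕ} {L : ℝ} (hq : 1 + q * L < 2 ^ q)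
    (hL : ∀ i, leverage V X₀ i ≤ L) (N : ℕ) (l : List ℕ) (hl : ∀ lo ∈ l, lo ≤ m)
    {H : γ → γ → Operand ι} {w : Fin m → ℝ} {X : Matrix γ γ ℝ}
    (hV : DenotesMat inp mem Vo V)
    (hS : ∀ j ≤ m, DenotesMat inp mem (S j) (moment V (headWeight m j)))
    (hH : DenotesMat inp mem H X) (hX : IsDesign V w X) {c : ℕ} (hc : c + N = Fintype.card γ * q)
    (hdet : 2 ^ c * (moment V w₀).det ≤ (moment V w).det)
    (htr : (X₀ * moment V w).trace ≤ Fintype.card γ + c * L) (hsum : ∑ i, w i ≤ ∑ i, w₀ i + c) :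
    Runs inp mem (sweep Vo S b N l H)
      (l.length * (4 * Fintype.card γ ^ 2) + N * ((12 + 5 * b) * Fintype.card γ ^ 2))
      (fun H' m' => ∃ w' X', DenotesMat inp m' H' X' ∧ IsDesign V w' X' ∧
        ∑ i, w' i ≤ ∑ i, w₀ i + (Fintype.card γ * q : ℕ) ∧
        (∀ i, leverage V X' i ≤ leverage V X i) ∧
        ∀ lo ∈ l, blockLeverage V X' lo (min (lo + b) m) ≤ b) := by
  have hk : 0 < Fintype.card γ := Fintype.card_pos
  have hk2 : Fintype.card γ ≤ Fintype.card γ ^ 2 := Nat.le_self_pow two_ne_zero _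
  fun_induction sweep Vo S b N l H generalizing mem w X c with
  | case1 N H =>
    refine Runs.pure ⟨w, X, hH, hX, hsum.trans ?_, fun _ => le_rfl, by simp⟩
    gcongr
    omega
  | case2 lo l H =>
    rw [add_zero] at hc
    subst hc
    exact absurd hdet (h₀.not_two_pow_le hX hq htr)
  | case3 N lo l H ih₁ ih₂ =>
    set k := Fintype.card γ with hkdef
    have hlo := hl lo (by simp)
    refine Runs.bind (runs_blockCode (V := V) (lo := lo) (hi := min (lo + b) m) (by omega) hH
      (hS _ (min_le_right _ _)) (hS _ hlo))
      (N' := 1 + (l.length * (4 * k ^ 2) + (N + 1) * ((12 + 5 * b) * k ^ 2))) ?_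
      fun s m₁ h₁ hs => ?_
    · simp only [List.length_cons, ← hkdef]
      nlinarith
    refine Runs.bind (runs_test hs (denotes_const (b : ℚ))) le_rfl fun r m₂ h₂ hr => ?_
    rw [Rat.cast_natCast] at hr
    replace h₂ := h₁.trans h₂
    by_cases hrt : r = true
    · rw [if_pos hrt]
      refine (ih₁ (fun lo h => hl lo (by simp [h])) (hV.mono h₂) (fun j hj => (hS j hj).mono h₂)
        (hH.mono h₂) hX hc hdet htr hsum).weaken le_rfl ?_
      rintro H' m' _ ⟨w', X', hH', hX', hsum', hle, hblock⟩
      refine ⟨w', X', hH', hX', hsum', hle, fun lo' h => ?_⟩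
      rcases List.mem_cons.1 h with rfl | h
      · exact (Finset.sum_le_sum fun i _ => hle i).trans (hr.1 hrt)
      · exact hblock lo' h
    · rw [if_neg hrt]
      have hlen : (blockRows m lo (min (lo + b) m)).length ≤ b := by
        rw [blockRows, Finset.length_toList]
        exact card_block_le m lo b
      refine Runs.bind ((runs_findCode (N := 5 * k ^ 2) (P := fun i => 1 < leverage V X i) _
        fun i _ m' h => ?_).mono (Nat.mul_le_mul_right _ hlen))
        (N' := 8 * k ^ 2 + (l.length * (4 * k ^ 2) + 4 * k ^ 2 + N * ((12 + 5 * b) * k ^ 2)))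
        (by ring_nf; rfl) ?_
      · refine Runs.bind (runs_leverageCode (hH.mono (h₂.trans h)) (hV.mono (h₂.trans h)) i)
          (N' := 1) (by nlinarith) fun x m'' h' hx => ?_
        refine Runs.bind (runs_test hx (denotes_const 1)) (N' := 0) le_rfl fun r m''' h'' hr => ?_
        refine Runs.pure ?_
        rw [Rat.cast_one] at hr
        rw [Bool.not_eq_true', ← Bool.not_eq_true, hr, not_le]
      rintro (_ | i) m₃ h₃ ⟨hnone, hsome⟩
      -- a block whose leverages add up to more than `b` has a row of leverage larger than one
      · exfalso
        refine hrt (hr.2 ?_)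
        have hle : ∀ i ∈ ({i : Fin m | lo ≤ (i : ℕ) ∧ (i : ℕ) < min (lo + b) m} : Finset (Fin m)),
            leverage V X i ≤ 1 := fun i hi => not_lt.1 (hnone rfl i (by
              rw [blockRows, Finset.mem_toList]
              exact hi))
        refine (Finset.sum_le_sum hle).trans ?_
        rw [Finset.sum_const, nsmul_eq_mul, mul_one]
        exact_mod_cast card_block_le m lo b
      · have hi := (hsome i rfl).2
        replace h₃ := h₂.trans h₃
        refine Runs.bind (runs_addRow (hV.mono h₃) (hH.mono h₃) i) le_rfl fun H' m₄ h₄ hH' => ?_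
        replace h₄ := h₃.trans h₄
        refine (ih₂ H' hl (hV.mono h₄) (fun j hj => (hS j hj).mono h₄) hH' (hX.add_single i)
          (c := c + 1) (by omega) ?_ ?_ ?_).weaken ?_ ?_
        · rw [hX.det_add_single, pow_succ]
          have := hX.posDef_moment.det_pos
          nlinarith
        · have hadd : ∑ j, (w + Pi.single i 1 : Fin m → ℝ) j * leverage V X₀ j =
              ∑ j, w j * leverage V X₀ j + leverage V X₀ i := by
            simp [add_mul, Finset.sum_add_distrib, Pi.single_apply]
          rw [← sum_mul_leverage] at htr ⊢
          rw [hadd]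
          have := hL i
          push_cast
          linarith
        · have hadd : ∑ j, (w + Pi.single i 1 : Fin m → ℝ) j = ∑ j, w j + 1 := by
            simp [Finset.sum_add_distrib]
          rw [hadd]
          push_cast
          linarith
        · simp only [List.length_cons]
          ring_nf
          rfl
        · rintro H'' m' _ ⟨w', X', hH', hX', hsum', hle, hblock⟩
          exact ⟨w', X', hH', hX', hsum', fun j => (hle j).trans (hX.leverage_add_single_le i j),
            hblock⟩

end Cover

/-! ### Refinement over dyadic blocks -/

section Refine

variable {ι γ : Type} [Fintype γ] [DecidableEq γ] {m : ℕ} {inp : ι → ℝ} {mem : List ℝ}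

/-- Multiplies a matrix by a constant. -/
noncomputable def scaleCode (c : ℚ) (H : γ → γ → Operand ι) : Code ι (γ → γ → Operand ι) :=
  tabMat fun a b => arith .mul (.const c) (H a b)

theorem runs_scaleCode {c : ℚ} {H : γ → γ → Operand ι} {X : Matrix γ γ ℝ}
    (hH : DenotesMat inp mem H X) :
    Runs inp mem (scaleCode c H) (Fintype.card γ ^ 2)
      (fun H' m' => DenotesMat inp m' H' ((c : ℝ) • X)) :=
  runs_tabMat (N := 1) (by ring_nf; rfl) fun a b _ h =>
    runs_arith (denotes_const c) ((hH a b).mono h)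

/-- The first rows of the blocks of `b` consecutive rows. -/
def blockStarts (m b : ℕ) : List ℕ := (List.range (m / b + 1)).map (b * ·)

theorem le_of_mem_blockStarts {b lo : ℕ} (h : lo ∈ blockStarts m b) : lo ≤ m := by
  simp only [blockStarts, List.mem_map, List.mem_range] at h
  obtain ⟨g, hg, rfl⟩ := h
  exact (Nat.mul_le_mul_left b (by omega)).trans (Nat.mul_div_le m b)

theorem IsDesign.leverage_le_of_blockLeverage_le {V : Matrix (Fin m) γ ℝ} {w : Fin m → ℝ}
    {X : Matrix γ γ ℝ} (h : IsDesign V w X) {b : ℕ} (hb : 0 < b)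
    (hblock : ∀ lo ∈ blockStarts m b, blockLeverage V X lo (min (lo + b) m) ≤ b) (i : Fin m) :
    leverage V X i ≤ b := by
  refine le_trans ?_ (hblock (b * (i / b)) ?_)
  · refine Finset.single_le_sum (f := leverage V X) (fun j _ => h.leverage_nonneg j) ?_
    have h₁ := Nat.div_add_mod (i : ℕ) b
    have h₂ := Nat.mod_lt (i : ℕ) hb
    have h₃ := i.2
    simp only [Finset.mem_filter, Finset.mem_univ, true_and, lt_min_iff]
    omega
  · simp only [blockStarts, List.mem_map, List.mem_range]
    exact ⟨i / b, Nat.lt_succ_of_le (Nat.div_le_div_right i.2.le), rfl⟩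

/-- Sweeps through the blocks of `2 ^ j` rows, then of `2 ^ (j - 1)` rows, down to single rows. The
scaling between two sweeps restores the total weight `k`. -/
noncomputable def refineCode (Vo : Fin m → γ → Operand ι) (S : ℕ → γ → γ → Operand ι) :
    ℕ → (γ → γ → Operand ι) → Code ι (γ → γ → Operand ι)
  | 0, H => sweep Vo S 1 (Fintype.card γ * 8) (blockStarts m 1) H
  | j + 1, H => do
    let H' ← sweep Vo S (2 ^ (j + 1)) (Fintype.card γ * (2 * (j + 1) + 8))
      (blockStarts m (2 ^ (j + 1))) H
    let H'' ← scaleCode (2 * (j + 1) + 9 : ℕ) H'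
    refineCode Vo S j H''

theorem one_add_mul_lt_two_pow (j : ℕ) :
    1 + (2 * j + 8) * (2 ^ (j + 1) * (2 * j + 11)) < 2 ^ (2 * j + 8) := by
  have h₁ : (2 * j + 8) * (2 * j + 11) + 1 ≤ 2 ^ (j + 7) := by
    induction j with
    | zero => norm_num
    | succ j ih =>
      have : 2 ^ (j + 1 + 7) = 2 * 2 ^ (j + 7) := by ring
      nlinarith
  have h₂ : 2 ^ (2 * j + 8) = 2 ^ (j + 1) * 2 ^ (j + 7) := by rw [← pow_add]; ring_nf
  have h₃ : 1 < 2 ^ (j + 1) := Nat.one_lt_two_pow (by omega)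
  rw [h₂]
  nlinarith

/-- The bound `2 ^ (j + 1) * (2 * j + 11)` on the leverages before level `j` is the bound
`2 ^ (j + 1)` left by the previous level, times the scaling factor `2 * (j + 1) + 9`. -/
theorem runs_sweep_level [Nonempty γ] {Vo : Fin m → γ → Operand ι} {V : Matrix (Fin m) γ ℝ}
    {S : ℕ → γ → γ → Operand ι} (j : ℕ) {w : Fin m → ℝ} {H : γ → γ → Operand ι} {X : Matrix γ γ ℝ}
    (hV : DenotesMat inp mem Vo V)
    (hS : ∀ j ≤ m, DenotesMat inp mem (S j) (moment V (headWeight m j)))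
    (hH : DenotesMat inp mem H X) (hX : IsDesign V w X) (hw : ∑ i, w i ≤ Fintype.card γ)
    (hL : ∀ i, leverage V X i ≤ (2 ^ (j + 1) * (2 * j + 11) : ℕ)) :
    Runs inp mem (sweep Vo S (2 ^ j) (Fintype.card γ * (2 * j + 8)) (blockStarts m (2 ^ j)) H)
      ((m / 2 ^ j + 1) * (4 * Fintype.card γ ^ 2) +
        Fintype.card γ * (2 * j + 8) * ((12 + 5 * 2 ^ j) * Fintype.card γ ^ 2))
      (fun H' m' => ∃ w' X', DenotesMat inp m' H' X' ∧ IsDesign V w' X' ∧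
        ∑ i, w' i ≤ (Fintype.card γ * (2 * j + 9) : ℕ) ∧ ∀ i, leverage V X' i ≤ (2 ^ j : ℕ)) := by
  have hq : 1 + ((2 * j + 8 : ℕ) : ℝ) * (2 ^ (j + 1) * (2 * j + 11) : ℕ) < 2 ^ (2 * j + 8) := by
    exact_mod_cast one_add_mul_lt_two_pow j
  refine (runs_sweep (2 ^ j) hX hq hL (Fintype.card γ * (2 * j + 8)) (blockStarts m (2 ^ j))
    (fun lo h => le_of_mem_blockStarts h) hV hS hH hX (c := 0) (by simp) (by simp) ?_
    (by simp)).weaken ?_ ?_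
  · simp [hX.mul_eq_one', Matrix.trace_one]
  · simp [blockStarts]
  · rintro H' m' _ ⟨w', X', hH', hX', hsum, -, hblock⟩
    refine ⟨w', X', hH', hX', ?_, hX'.leverage_le_of_blockLeverage_le (by positivity) hblock⟩
    push_cast at hsum ⊢
    linarith

/-- The sum of the bounds of `runs_sweep_level` over the levels `0, …, j`, and of the costs of the
scalings. -/
def refineCost (m k : ℕ) : ℕ → ℕ
  | 0 => (m / 2 ^ 0 + 1) * (4 * k ^ 2) + k * (2 * 0 + 8) * ((12 + 5 * 2 ^ 0) * k ^ 2)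
  | j + 1 => (m / 2 ^ (j + 1) + 1) * (4 * k ^ 2) +
      k * (2 * (j + 1) + 8) * ((12 + 5 * 2 ^ (j + 1)) * k ^ 2) + (k ^ 2 + refineCost m k j)

theorem runs_refineCode [Nonempty γ] {Vo : Fin m → γ → Operand ι} {V : Matrix (Fin m) γ ℝ}
    {S : ℕ → γ → γ → Operand ι} (j : ℕ) {w : Fin m → ℝ} {H : γ → γ → Operand ι} {X : Matrix γ γ ℝ}
    (hV : DenotesMat inp mem Vo V)
    (hS : ∀ j ≤ m, DenotesMat inp mem (S j) (moment V (headWeight m j)))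
    (hH : DenotesMat inp mem H X) (hX : IsDesign V w X) (hw : ∑ i, w i ≤ Fintype.card γ)
    (hL : ∀ i, leverage V X i ≤ (2 ^ (j + 1) * (2 * j + 11) : ℕ)) :
    Runs inp mem (refineCode Vo S j H) (refineCost m (Fintype.card γ) j)
      (fun H' m' => ∃ w' X', DenotesMat inp m' H' X' ∧ IsDesign V w' X' ∧
        ∑ i, w' i ≤ 9 * Fintype.card γ ∧ ∀ i, leverage V X' i ≤ 1) := by
  induction j generalizing mem w H X with
  | zero =>
    refine (runs_sweep_level 0 hV hS hH hX hw hL).weaken le_rfl ?_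
    rintro H' m' _ ⟨w', X', hH', hX', hsum, hlev⟩
    refine ⟨w', X', hH', hX', ?_, by simpa using hlev⟩
    push_cast at hsum
    linarith
  | succ j ih =>
    refine Runs.bind (runs_sweep_level (j + 1) hV hS hH hX hw hL) le_rfl ?_
    rintro H' m₁ h₁ ⟨w', X', hH', hX', hsum, hlev⟩
    refine Runs.bind (runs_scaleCode hH') le_rfl fun H'' m₂ h₂ hH'' => ?_
    rw [Rat.cast_natCast] at hH''
    have hpos : (0 : ℝ) < (2 * (j + 1) + 9 : ℕ) := by positivity
    refine ih (hV.mono (h₁.trans h₂)) (fun j hj => (hS j hj).mono (h₁.trans h₂)) hH''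
      (hX'.smul hpos) ?_ fun i => ?_
    · simp only [Pi.smul_apply, smul_eq_mul, ← Finset.mul_sum]
      rw [inv_mul_le_iff₀ hpos]
      push_cast at hsum ⊢
      linarith
    · have : leverage V ((((2 * (j + 1) + 9 : ℕ) : ℝ)) • X') i =
          ((2 * (j + 1) + 9 : ℕ) : ℝ) * leverage V X' i := by
        simp [leverage, smul_mulVec]
      rw [this]
      calc ((2 * (j + 1) + 9 : ℕ) : ℝ) * leverage V X' i
          ≤ ((2 * (j + 1) + 9 : ℕ) : ℝ) * (2 ^ (j + 1) : ℕ) :=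
            mul_le_mul_of_nonneg_left (hlev i) hpos.le
        _ = _ := by push_cast; ring

/-- The numbers of blocks decrease geometrically, and the costs of the additions increase
geometrically, with the level. -/
theorem refineCost_le {m k : ℕ} (hk : 0 < k) (j : ℕ) :
    refineCost m k j + 4 * k ^ 2 * (m / 2 ^ j) ≤
      k ^ 2 * (8 * m + 36 * (k * (2 * j + 8) * 2 ^ j)) := by
  have hlevel : ∀ j, (m / 2 ^ j + 1) * (4 * k ^ 2) +
      k * (2 * j + 8) * ((12 + 5 * 2 ^ j) * k ^ 2) + k ^ 2 ≤
      k ^ 2 * (4 * (m / 2 ^ j) + 18 * (k * (2 * j + 8) * 2 ^ j)) := by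
    intro j
    have h₁ : 1 ≤ 2 ^ j := Nat.one_le_two_pow
    have h₂ : 1 * (2 * j + 8) ≤ k * (2 * j + 8) := Nat.mul_le_mul_right _ hk
    have h₃ : k * (2 * j + 8) * 1 ≤ k * (2 * j + 8) * 2 ^ j := Nat.mul_le_mul_left _ h₁
    calc _ = k ^ 2 * (4 * (m / 2 ^ j) + (5 + 12 * (k * (2 * j + 8) * 1) +
          5 * (k * (2 * j + 8) * 2 ^ j))) := by ring
      _ ≤ _ := by
        refine Nat.mul_le_mul_left _ ?_
        omega
  induction j with
  | zero =>
    have := hlevel 0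
    simp only [refineCost, pow_zero, Nat.div_one] at this ⊢
    nlinarith
  | succ j ih =>
    have h := hlevel (j + 1)
    have hdiv : 2 * (m / 2 ^ (j + 1)) ≤ m / 2 ^ j := by
      rw [pow_succ, ← Nat.div_div_eq_div_mul]
      omega
    have hdiv' : 4 * k ^ 2 * (2 * (m / 2 ^ (j + 1))) ≤ 4 * k ^ 2 * (m / 2 ^ j) :=
      Nat.mul_le_mul_left _ hdiv
    have hpow : k ^ 2 * (18 * (k * (2 * (j + 1) + 8) * 2 ^ (j + 1))) +
        k ^ 2 * (36 * (k * (2 * j + 8) * 2 ^ j)) ≤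
        k ^ 2 * (36 * (k * (2 * (j + 1) + 8) * 2 ^ (j + 1))) := by
      rw [← mul_add]
      refine Nat.mul_le_mul_left _ ?_
      rw [pow_succ]
      have : k * (2 * j + 8) * 2 ^ j ≤ k * (2 * (j + 1) + 8) * 2 ^ j := by gcongr; omega
      nlinarith
    simp only [refineCost]
    rw [mul_add] at h ih ⊢
    linarith

/-- Adds one to the weights of all rows of a list. -/
noncomputable def addRows (Vo : Fin m → γ → Operand ι) :
    List (Fin m) → (γ → γ → Operand ι) → Code ι (γ → γ → Operand ι)
  | [], H => pure H
  | i :: l, H => do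
    let H' ← addRow Vo H i
    addRows Vo l H'

theorem runs_addRows [Nonempty γ] {Vo : Fin m → γ → Operand ι} {V : Matrix (Fin m) γ ℝ}
    (l : List (Fin m)) {w : Fin m → ℝ} {H : γ → γ → Operand ι} {X : Matrix γ γ ℝ}
    (hV : DenotesMat inp mem Vo V) (hH : DenotesMat inp mem H X) (hX : IsDesign V w X) :
    Runs inp mem (addRows Vo l H) (l.length * (8 * Fintype.card γ ^ 2))
      (fun H' m' => ∃ w' X', DenotesMat inp m' H' X' ∧ IsDesign V w' X' ∧
        ∑ i, w' i = ∑ i, w i + l.length ∧ ∀ i, (i ∈ l ∨ leverage V X i ≤ 1) →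
          leverage V X' i ≤ 1) := by
  induction l generalizing mem w H X with
  | nil => exact Runs.pure ⟨w, X, hH, hX, by simp, by simp⟩
  | cons i l ih =>
    refine Runs.bind (runs_addRow hV hH i) (N' := l.length * (8 * Fintype.card γ ^ 2))
      (by simp only [List.length_cons]; ring_nf; rfl) fun H' m₁ h₁ hH' => ?_
    refine (ih (hV.mono h₁) hH' (hX.add_single i)).weaken le_rfl ?_
    rintro H'' m' _ ⟨w', X', hH'', hX', hsum, hlev⟩
    refine ⟨w', X', hH'', hX', ?_, fun j hj => hlev j ?_⟩
    · rw [hsum]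
      simp [Finset.sum_add_distrib]
      ring
    · rcases hj with hj | hj
      · rcases List.mem_cons.1 hj with rfl | hj
        · exact Or.inr (hX.leverage_add_single_self j)
        · exact Or.inl hj
      · exact Or.inr ((hX.leverage_add_single_le i j).trans hj)

/-- The level from which the refinement starts: `2m / k` bounds the leverages for equal weights. -/
noncomputable def startLevel (m k : ℕ) : ℕ := sInf {j | 2 * m ≤ k * (2 ^ (j + 1) * (2 * j + 11))}

theorem startLevel_spec {k : ℕ} (hk : 0 < k) (m : ℕ) :
    2 * m ≤ k * (2 ^ (startLevel m k + 1) * (2 * startLevel m k + 11)) := by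
  refine Nat.sInf_mem (s := {j | 2 * m ≤ k * (2 ^ (j + 1) * (2 * j + 11))}) ⟨m, ?_⟩
  have h₁ : m < 2 ^ m := Nat.lt_two_pow_self
  have h₂ : 1 * (2 ^ (m + 1) * 1) ≤ k * (2 ^ (m + 1) * (2 * m + 11)) := by
    gcongr <;> omega
  show 2 * m ≤ k * (2 ^ (m + 1) * (2 * m + 11))
  rw [pow_succ] at h₂ ⊢
  omega

theorem startLevel_cost {m k : ℕ} (hkm : k ≤ m) :
    k * (2 * startLevel m k + 8) * 2 ^ startLevel m k ≤ 8 * m := by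
  rcases Nat.eq_zero_or_pos (startLevel m k) with h | h
  · rw [h]
    omega
  · have hlt : startLevel m k - 1 < startLevel m k := by omega
    have := Nat.notMem_of_lt_sInf hlt
    obtain ⟨j, hj⟩ : ∃ j, startLevel m k = j + 1 := ⟨startLevel m k - 1, by omega⟩
    rw [hj] at this ⊢
    simp only [Nat.add_sub_cancel, Set.mem_ofPred_eq, not_le] at this
    calc k * (2 * (j + 1) + 8) * 2 ^ (j + 1) ≤ k * (2 * j + 11) * 2 ^ (j + 1) :=
          Nat.mul_le_mul_right _ (Nat.mul_le_mul_left _ (by omega))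
      _ = k * (2 ^ (j + 1) * (2 * j + 11)) := by ring
      _ ≤ 8 * m := by linarith

/-- The inverse moment matrix of a design of total weight at most `9 k` with all leverages at most
one, for a matrix `V` that contains the unit rows. The moment matrix of the unit rows is the identity;
adding all rows to them makes all leverages at most one, and the scaling makes the total weight at
most `k`. -/
noncomputable def coverCode (Vo : Fin m → γ → Operand ι) : Code ι (γ → γ → Operand ι) := do
  let H₁ ← addRows Vo (List.finRange m) fun a b => .const (if a = b then 1 else 0)
  let H₂ ← scaleCode (2 * m / Fintype.card γ) H₁
  let S ← prefixMoments Vo m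
  refineCode Vo S (startLevel m (Fintype.card γ)) H₂

theorem runs_coverCode [Nonempty γ] {Vo : Fin m → γ → Operand ι} {V : Matrix (Fin m) γ ℝ}
    (hV : DenotesMat inp mem Vo V) {I : γ → Fin m} (hI : V.submatrix I id = 1)
    (hkm : Fintype.card γ ≤ m) :
    Runs inp mem (coverCode Vo) (307 * (m * Fintype.card γ ^ 2))
      (fun H m' => ∃ w X, DenotesMat inp m' H X ∧ IsDesign V w X ∧
        ∑ i, w i ≤ 9 * Fintype.card γ ∧ ∀ i, leverage V X i ≤ 1) := by
  have hk : 0 < Fintype.card γ := Fintype.card_pos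
  set k := Fintype.card γ with hkdef
  have hm : 0 < m := by omega
  have hrow : ∀ a b, V (I a) b = if a = b then 1 else 0 := fun a b => by
    have := congrFun (congrFun hI a) b
    simpa [Matrix.one_apply] using this
  let w₀ : Fin m → ℝ := fun i => ∑ a, if I a = i then 1 else 0
  have hw₀ : ∑ i, w₀ i = k := by
    rw [Finset.sum_comm]
    simp [hkdef]
  have h₀ : IsDesign V w₀ (1 : Matrix γ γ ℝ) := by
    refine ⟨fun i => Finset.sum_nonneg fun a _ => by split_ifs <;> norm_num, ?_⟩
    rw [Matrix.mul_one]
    ext a b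
    rw [moment_apply]
    simp only [w₀, Finset.sum_mul]
    rw [Finset.sum_comm]
    simp [hrow, Matrix.one_apply, eq_comm]
  have hcost : refineCost m k (startLevel m k) ≤ 296 * (m * k ^ 2) := by
    have h₁ := refineCost_le (m := m) hk (startLevel m k)
    have h₂ := startLevel_cost hkm
    have h₃ : k ^ 2 * (8 * m + 36 * (k * (2 * startLevel m k + 8) * 2 ^ startLevel m k)) ≤
        k ^ 2 * (8 * m + 36 * (8 * m)) := by gcongr
    have h₄ : k ^ 2 * (8 * m + 36 * (8 * m)) = 296 * (m * k ^ 2) := by ring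
    exact ((Nat.le_add_right _ _).trans h₁).trans (h₃.trans h₄.le)
  refine Runs.bind (runs_addRows (V := V) (w := w₀) (X := 1) (List.finRange m) hV
    (fun a b => ?_) h₀)
    (N' := k ^ 2 + (m * (2 * k ^ 2) + refineCost m k (startLevel m k))) ?_ ?_
  · have := denotes_const (inp := inp) (mem := mem) (if a = b then 1 else 0 : ℚ)
    rwa [apply_ite Rat.cast, Rat.cast_one, Rat.cast_zero, ← Matrix.one_apply] at this
  · have : 1 * k ^ 2 ≤ m * k ^ 2 := Nat.mul_le_mul_right _ hm
    simp only [List.length_finRange, ← hkdef]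
    nlinarith
  rintro H₁ m₁ h₁ ⟨w₁, X₁, hH₁, hX₁, hsum₁, hlev₁⟩
  refine Runs.bind (runs_scaleCode hH₁) le_rfl fun H₂ m₂ h₂ hH₂ => ?_
  replace h₂ := h₁.trans h₂
  refine Runs.bind (runs_prefixMoments (hV.mono h₂) m le_rfl) le_rfl fun S m₃ h₃ hS => ?_
  have hk' : (0 : ℝ) < k := by exact_mod_cast hk
  have hm' : (0 : ℝ) < m := by exact_mod_cast hm
  have hkm' : (k : ℝ) ≤ m := by exact_mod_cast hkm
  push_cast at hH₂
  have hpos : (0 : ℝ) < 2 * m / k := by positivity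
  refine runs_refineCode _ (hV.mono (h₂.trans h₃)) hS (hH₂.mono h₃) (hX₁.smul hpos) ?_ fun i => ?_
  · simp only [Pi.smul_apply, smul_eq_mul, ← Finset.mul_sum]
    rw [inv_mul_le_iff₀ hpos, hsum₁, hw₀, List.length_finRange, div_mul_cancel₀ _ hk'.ne']
    linarith
  · have hsmul : leverage V ((2 * (m : ℝ) / k) • X₁) i = 2 * m / k * leverage V X₁ i := by
      simp [leverage, smul_mulVec]
    rw [hsmul]
    have h₅ : ((2 * m : ℕ) : ℝ) ≤
        (k * (2 ^ (startLevel m k + 1) * (2 * startLevel m k + 11)) : ℕ) :=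
      Nat.cast_le.2 (startLevel_spec hk m)
    calc 2 * m / k * leverage V X₁ i ≤ 2 * m / k * 1 :=
          mul_le_mul_of_nonneg_left (hlev₁ i (Or.inl (List.mem_finRange i))) hpos.le
      _ ≤ _ := by
          rw [mul_one, div_le_iff₀ hk', mul_comm _ (k : ℝ)]
          exact_mod_cast h₅

end Refine

/-! ### Well-conditioned rows and the decomposition program -/

section Decomposition

/-- Elimination from scratch: every row is searched once, and every column is cleared at most once. -/
theorem runs_eliminate_none {ι β γ : Type} [Fintype β] [Fintype γ] [DecidableEq β] [DecidableEq γ]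
    {inp : ι → ℝ} {mem : List ℝ} {K : ℕ} {M : Matrix β γ ℝ} {l : List β}
    {E : β → γ → Operand ι} (hE : DenotesMat inp mem E M)
    (hK : l.length * (2 * Fintype.card γ) +
      Fintype.card γ * (3 * (Fintype.card β * Fintype.card γ)) ≤ K) :
    Runs inp mem (eliminate l E fun _ => none) K
      (fun out m => ∃ X, DenotesMat inp m out.1 X ∧ IsReduction M X out.2 ∧
        (∀ i ∈ l, ∀ c, out.2 c = none → X i c = 0) ∧ ∀ c i, out.2 c = some i → i ∈ l) := by
  refine (runs_eliminate l hE (IsReduction.refl M)).weaken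
    ((Nat.add_le_add_left (Nat.mul_le_mul_right _ (Finset.card_le_univ _)) _).trans hK) ?_
  rintro out m _ ⟨X, hX, hred, hz, hs⟩
  exact ⟨X, hX, hred, fun i hi => hz i (Or.inl hi), fun c i h => by simpa using hs c i h⟩

variable {ι : Type} {inp : ι → ℝ} {mem : List ℝ} {m k r : ℕ}

/-- If the Gram determinant of `k` rows is as large as greedy selection with total weight `9k` makes
it, the moment determinant exceeds their squared determinant at most by `(9k)^k / k! ≤ (9e)^k`. -/
theorem det_moment_le_of_gram {V : Matrix (Fin m) (Fin k) ℝ} {w : Fin m → ℝ}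
    {H : Matrix (Fin k) (Fin k) ℝ} (hk : 0 < k) (h : IsDesign V w H) {S : Fin k → Fin m}
    (hS : (k.factorial : ℝ) / (9 * k) ^ k ≤ (gram V H S).det) :
    (moment V w).det ≤ 4 ^ (3 * k) * (V.submatrix S id).det ^ 2 := by
  have hk' : (0 : ℝ) < k := by exact_mod_cast hk
  have hD : 0 < (moment V w).det := h.posDef_moment.det_pos
  have h1 : (moment V w).det * H.det = 1 := by
    rw [← det_mul, h.mul_eq_one, det_one]
  rw [gram, det_mul, det_mul, det_transpose, div_le_iff₀ (by positivity)] at hS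
  -- `k ^ k / k!` is a term of the power series of `exp k`
  have hexp : (k : ℝ) ^ k / k.factorial ≤ 3 ^ k := by
    refine (Real.pow_div_factorial_le_exp (k : ℝ) hk'.le k).trans ?_
    rw [← mul_one (k : ℝ), Real.exp_nat_mul]
    exact pow_le_pow_left₀ (Real.exp_pos _).le Real.exp_one_lt_three.le _
  rw [div_le_iff₀ (by positivity)] at hexp
  have hf : (0 : ℝ) < k.factorial := by positivity
  refine le_of_mul_le_mul_right ?_ hf
  calc (moment V w).det * k.factorial
      ≤ (moment V w).det * ((V.submatrix S id).det * H.det * (V.submatrix S id).det *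
          (9 * k) ^ k) := mul_le_mul_of_nonneg_left hS hD.le
    _ = (moment V w).det * H.det * ((V.submatrix S id).det ^ 2 * (9 ^ k * (k : ℝ) ^ k)) := by
        rw [mul_pow]
        ring
    _ ≤ (V.submatrix S id).det ^ 2 * (9 ^ k * (3 ^ k * k.factorial)) := by
        rw [h1, one_mul]
        gcongr
    _ = 27 ^ k * (V.submatrix S id).det ^ 2 * k.factorial := by
        rw [show (27 : ℝ) = 9 * 3 by norm_num, mul_pow]
        ring
    _ ≤ 4 ^ (3 * k) * (V.submatrix S id).det ^ 2 * k.factorial := by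
        rw [pow_mul]
        gcongr
        norm_num

/-- Elimination restricted to the rows `S` of `V` turns `V` into the matrix of its coordinates with
respect to these rows, if they are linearly independent. -/
theorem IsReduction.isInterpolation {V E : Matrix (Fin m) (Fin k) ℝ} {ρ : Fin k → Option (Fin m)}
    (h : IsReduction V E ρ) {S : Fin k → Fin m} (hS : (V.submatrix S id).det ≠ 0)
    (hzero : ∀ a c, ρ c = none → E (S a) c = 0)
    (hmem : ∀ c i, ρ c = some i → i ∈ Set.range S) (p₀ : Fin m) :
    IsInterpolation V E (fun c => (ρ c).getD p₀) ∧
      (V.submatrix (fun c => (ρ c).getD p₀) id).det ^ 2 = (V.submatrix S id).det ^ 2 := by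
  obtain ⟨⟨R, hR⟩, -, hrow⟩ := h
  have hsub : ∀ f : Fin k → Fin m, V.submatrix f id = E.submatrix f id * R := fun f => by
    conv_lhs => rw [hR]
    rfl
  -- a column without a pivot row would vanish on `S`
  have hsome : ∀ c, ρ c = some ((ρ c).getD p₀) := by
    intro c
    rcases hc : ρ c with _ | i
    · refine absurd ?_ hS
      rw [hsub, det_mul, det_eq_zero_of_column_eq_zero (A := E.submatrix S id) c fun a => hzero a c hc,
        zero_mul]
    · rfl
  have hone : E.submatrix (fun c => (ρ c).getD p₀) id = 1 := by
    ext c c'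
    rw [submatrix_apply, hrow c _ (hsome c), Matrix.one_apply]
    simp [eq_comm]
  refine ⟨⟨?_, hone⟩, ?_⟩
  -- `R` is the matrix of the pivot rows of `V`
  · rw [hsub, hone, Matrix.one_mul]
    exact hR
  -- the pivot rows are a permutation of the rows `S`
  · choose τ hτ using fun c => hmem c _ (hsome c)
    have hτ_inj : Function.Injective τ := by
      intro c c' hcc
      have hρ : (ρ c).getD p₀ = (ρ c').getD p₀ := by rw [← hτ c, ← hτ c', hcc]
      by_contra hne
      have h₁ := hrow c _ (hsome c) c
      rw [hρ, hrow c' _ (hsome c') c] at h₁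
      simp [hne] at h₁
    have hperm : V.submatrix (fun c => (ρ c).getD p₀) id =
        (V.submatrix S id).submatrix
          (Equiv.ofBijective τ (Finite.injective_iff_bijective.1 hτ_inj)) id := by
      ext c c'
      simp [hτ]
    rw [hperm, det_permute, mul_pow]
    rcases Int.units_eq_one_or (Equiv.Perm.sign
      (Equiv.ofBijective τ (Finite.injective_iff_bijective.1 hτ_inj))) with h | h <;> simp [h]

/-- Finds rows of a matrix of full column rank with respect to which all rows have coordinates of
absolute value at most two, and computes these coordinates. -/
noncomputable def wellConditionedCode (p₀ : Fin m) (Vo : Fin m → Fin k → Operand ι) :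
    Code ι ((Fin m → Fin k → Operand ι) × (Fin k → Fin m)) := do
  let H ← coverCode Vo
  let lev ← tab fun i => leverageCode H (Vo i)
  let S ← greedy p₀ Vo k H lev
  let out ← eliminate (List.ofFn S) Vo fun _ => none
  exchange (3 * k) out.1 fun c => (out.2 c).getD p₀

theorem runs_wellConditionedCode (hk : 0 < k) (hkm : k ≤ m) (p₀ : Fin m)
    {Vo : Fin m → Fin k → Operand ι} {V : Matrix (Fin m) (Fin k) ℝ}
    (hV : DenotesMat inp mem Vo V) {I : Fin k → Fin m} (hI : V.submatrix I id = 1) :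
    Runs inp mem (wellConditionedCode p₀ Vo) (342 * (m * k ^ 2))
      (fun out m => ∃ X, DenotesMat inp m out.1 X ∧ IsInterpolation V X out.2 ∧
        ∀ i a, |X i a| ≤ 2) := by
  have : Nonempty (Fin k) := ⟨⟨0, hk⟩⟩
  have hk' : (0 : ℝ) < k := by exact_mod_cast hk
  have hmk : k * k ^ 2 ≤ m * k ^ 2 := Nat.mul_le_mul_right _ hkm
  have hmk₁ : m * k ≤ m * k ^ 2 := Nat.mul_le_mul_left _ (Nat.le_self_pow two_ne_zero k)
  have hk₂ : k ^ 2 ≤ m * k ^ 2 := Nat.le_mul_of_pos_left _ (hk.trans_le hkm)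
  refine Runs.bind (runs_coverCode hV hI (by simpa using hkm)) (N' := 35 * (m * k ^ 2))
    (by simp only [Fintype.card_fin]; linarith) fun H m₁ h₁ ⟨w, X, hH, hX, hw, hlev⟩ => ?_
  have hV₁ := hV.mono h₁
  refine Runs.bind (runs_tab (N := 4 * k ^ 2) (K := 4 * (m * k ^ 2)) (x := leverage V X)
    (by rw [Fintype.card_fin]; linarith) fun i m' h => by
      simpa using runs_leverageCode (hH.mono h) (hV₁.mono h) i)
    (N' := 31 * (m * k ^ 2)) (by linarith) fun lev m₂ h₂ hl => ?_
  have hV₂ := hV₁.mono h₂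
  have hdefl : IsDeflated V w X k := by simpa using hX.isDeflated
  refine Runs.bind ((runs_greedy (W := 9 * k) (by positivity) (by simpa using hw) k hV₂
    (hH.mono h₂) hl hdefl).mono (N' := 11 * (m * k ^ 2)) ?_)
    (N' := 20 * (m * k ^ 2)) (by linarith) fun S m₃ h₃ hS => ?_
  · simp only [Fintype.card_fin]
    nlinarith
  have hV₃ := hV₂.mono h₃
  have hdet := det_moment_le_of_gram hk hX hS
  have hD : 0 < (moment V w).det := hX.posDef_moment.det_pos
  have hne : (V.submatrix S id).det ≠ 0 := fun h0 => by
    rw [h0] at hdet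
    norm_num at hdet
    linarith
  refine Runs.bind (runs_eliminate_none (K := 5 * (m * k ^ 2)) (l := List.ofFn S) hV₃ ?_)
    (N' := 15 * (m * k ^ 2)) (by linarith) ?_
  · simp only [List.length_ofFn, Fintype.card_fin]
    nlinarith
  rintro out m₄ h₄ ⟨E, hE, hred, hz, hs⟩
  obtain ⟨hint, hsq⟩ := hred.isInterpolation hne
    (fun a c hc => hz (S a) (List.mem_ofFn.2 ⟨a, rfl⟩) c hc)
    (fun c i hc => by simpa using hs c i hc) p₀
  refine (runs_exchange hD (hX.det_sq_le hlev) (3 * k) hE hint (by rw [hsq]; exact hdet)).mono ?_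
  simp only [Fintype.card_fin]
  ring_nf
  rfl

/-- Replaces rows `I` that form an identity matrix by rows with small coordinates. If there are no
columns, there is nothing to do. -/
noncomputable def improveCode (I : Fin k → Fin m) (Vo : Fin m → Fin k → Operand ι) :
    Code ι ((Fin m → Fin k → Operand ι) × (Fin k → Fin m)) :=
  if h : 0 < k then wellConditionedCode (I ⟨0, h⟩) Vo else pure (Vo, I)

theorem runs_improveCode (hkm : k ≤ m) {Vo : Fin m → Fin k → Operand ι}
    {V : Matrix (Fin m) (Fin k) ℝ} (hV : DenotesMat inp mem Vo V) {I : Fin k → Fin m}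
    (hI : V.submatrix I id = 1) :
    Runs inp mem (improveCode I Vo) (342 * (m * k ^ 2))
      (fun out m => ∃ X, DenotesMat inp m out.1 X ∧ IsInterpolation V X out.2 ∧
        ∀ i a, |X i a| ≤ 2) := by
  unfold improveCode
  split_ifs with hk
  · exact runs_wellConditionedCode hk hkm _ hV hI
  · obtain rfl : k = 0 := by omega
    refine Runs.pure ⟨V, hV, ⟨?_, hI⟩, fun _ a => isEmptyElim a⟩
    ext i a
    exact isEmptyElim a

/-- The decomposition data with selected rows `ρ` for which `U` has the entries `F`. -/
noncomputable def IDData.ofEmbedding {R : Type} (ρ : Fin k ↪ Fin m)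
    (F : Fin m → Fin k → R) : IDData m R :=
  let σ : Fin k ⊕ Fin (Fintype.card {i // i ∉ Set.range ρ}) ≃ Fin m :=
    (Equiv.sumCongr (Equiv.ofInjective ρ ρ.injective) (Fintype.equivFin _).symm).trans
      (Equiv.Set.sumCompl (Set.range ρ))
  { k := k
    l := Fintype.card {i // i ∉ Set.range ρ}
    σ := σ
    G := fun b a => F (σ (Sum.inr b)) a }

open Classical in
/-- `IDData.ofEmbedding`, with the decomposition data of the zero matrix as junk value if `ρ` is not
injective. -/
noncomputable def IDData.ofRows {R : Type} (ρ : Fin k → Fin m) (F : Fin m → Fin k → R) :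
    IDData m R :=
  if h : Function.Injective ρ then IDData.ofEmbedding ⟨ρ, h⟩ F
  else IDData.ofEmbedding (k := 0) Function.Embedding.ofIsEmpty fun _ => Fin.elim0

theorem IDData.rows_ofEmbedding {R : Type} (ρ : Fin k ↪ Fin m) (F : Fin m → Fin k → R) :
    (IDData.ofEmbedding ρ F).rows = ρ := by
  funext a
  rfl

theorem IDData.U_apply (D : IDData m ℝ) (i : Fin m) :
    D.U i = fromRows (1 : Matrix (Fin D.k) (Fin D.k) ℝ) D.G (D.σ.symm i) := by
  rw [IDData.U, IDData.P, PEquiv.toMatrix_toPEquiv_mul]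
  rfl

theorem IDData.U_ofEmbedding {ρ : Fin k ↪ Fin m} {F : Matrix (Fin m) (Fin k) ℝ}
    (h : F.submatrix ρ id = 1) : (IDData.ofEmbedding ρ F).U = F := by
  funext i
  rw [IDData.U_apply]
  obtain ⟨x | x, rfl⟩ := (IDData.ofEmbedding ρ F).σ.surjective i
  · rw [Equiv.symm_apply_apply]
    have hx : (IDData.ofEmbedding ρ F).σ (Sum.inl x) = ρ x :=
      congrFun (IDData.rows_ofEmbedding ρ F) x
    rw [hx]
    exact (congrFun h x).symm
  · rw [Equiv.symm_apply_apply]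
    rfl

/-- The columns of `V` are a basis of the column space of `M`, normalized such that the rows `I` of
`V` are the unit vectors. -/
structure IsColumnBasis (M : Matrix (Fin m) (Fin r) ℝ) (V : Matrix (Fin m) (Fin k) ℝ)
    (I : Fin k → Fin m) : Prop where
  eq_mul : M = V * M.submatrix I id
  exists_mul_eq : ∃ Q : Matrix (Fin r) (Fin k) ℝ, V = M * Q
  row : V.submatrix I id = 1

theorem IsColumnBasis.rank_eq {M : Matrix (Fin m) (Fin r) ℝ} {V : Matrix (Fin m) (Fin k) ℝ}
    {I : Fin k → Fin m} (h : IsColumnBasis M V I) : M.rank = k := by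
  refine le_antisymm ?_ ?_
  · rw [h.eq_mul]
    exact (rank_mul_le_left _ _).trans (by simpa using V.rank_le_card_width)
  · obtain ⟨Q, hQ⟩ := h.exists_mul_eq
    calc k = (V.submatrix I id).rank := by rw [h.row, rank_one, Fintype.card_fin]
      _ ≤ V.rank := rank_submatrix_le _ _ _
      _ ≤ M.rank := by
        rw [hQ]
        exact rank_mul_le_left _ _

/-- The rows that interpolate `V` also interpolate `M = V M_I`. -/
theorem IsColumnBasis.isID {M : Matrix (Fin m) (Fin r) ℝ} {V X : Matrix (Fin m) (Fin k) ℝ}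
    {I : Fin k → Fin m} (h : IsColumnBasis M V I) {ρ : Fin k ↪ Fin m}
    (hX : IsInterpolation V X ρ) (hle : ∀ i a, |X i a| ≤ 2) :
    IsID M (IDData.ofEmbedding ρ X) where
  card_rows := h.rank_eq.symm
  factor := by
    have hsub : M.submatrix ρ id = V.submatrix ρ id * M.submatrix I id := by
      conv_lhs => rw [h.eq_mul]
      rfl
    have hM : M = X * M.submatrix ρ id := by
      rw [hsub, ← Matrix.mul_assoc, ← hX.eq_mul]
      exact h.eq_mul
    have hU : (IDData.ofEmbedding ρ X).U = X := IDData.U_ofEmbedding hX.row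
    have hρ : (IDData.ofEmbedding ρ (X : Fin m → Fin k → ℝ)).rows = ρ :=
      IDData.rows_ofEmbedding ρ X
    exact hM.trans (congrArg₂ (fun (A : Matrix (Fin m) (Fin k) ℝ) (f : Fin k → Fin m) =>
      A * M.submatrix f id) hU.symm hρ.symm)
  bound := fun b a => hle _ a

theorem IsInterpolation.injective {V X : Matrix (Fin m) (Fin k) ℝ} {ρ : Fin k → Fin m}
    (h : IsInterpolation V X ρ) : Function.Injective ρ := by
  intro a b hab
  by_contra hne
  have h₁ := congrFun (congrFun h.row a) a
  have h₂ := congrFun (congrFun h.row b) a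
  rw [submatrix_apply, hab, Matrix.one_apply_eq] at h₁
  rw [submatrix_apply, h₁, Matrix.one_apply_ne (Ne.symm hne)] at h₂
  exact one_ne_zero h₂

/-- The columns that have a pivot row. -/
noncomputable def pivotColumn (ρ : Fin r → Option (Fin m)) :
    Fin (Fintype.card {c // (ρ c).isSome}) ≃ {c // (ρ c).isSome} :=
  (Fintype.equivFin _).symm

/-- The pivot rows. -/
noncomputable def pivotRow (ρ : Fin r → Option (Fin m))
    (a : Fin (Fintype.card {c // (ρ c).isSome})) : Fin m :=
  (ρ (pivotColumn ρ a).1).get (pivotColumn ρ a).2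

theorem IsReduction.isColumnBasis {M E : Matrix (Fin m) (Fin r) ℝ} {ρ : Fin r → Option (Fin m)}
    (h : IsReduction M E ρ) (hzero : ∀ i c, ρ c = none → E i c = 0) :
    IsColumnBasis M (E.submatrix id fun a => (pivotColumn ρ a).1) (pivotRow ρ) := by
  have hrow : ∀ a c, E (pivotRow ρ a) c = if c = (pivotColumn ρ a).1 then 1 else 0 := fun a =>
    h.row _ _ (Option.some_get _).symm
  refine ⟨?_, ?_, ?_⟩
  · obtain ⟨R, hR⟩ := h.exists_eq_mul
    ext i j
    have hM : ∀ a, M (pivotRow ρ a) j = R (pivotColumn ρ a).1 j := fun a => by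
      conv_lhs => rw [hR]
      simp [Matrix.mul_apply, hrow]
    rw [Matrix.mul_apply]
    simp only [submatrix_apply, id, hM]
    rw [(pivotColumn ρ).sum_comp fun c => E i c.1 * R c.1 j]
    conv_lhs => rw [hR, Matrix.mul_apply]
    rw [← Finset.sum_subtype (Finset.univ.filter fun c => (ρ c).isSome) (by simp)
      fun c => E i c * R c j]
    refine (Finset.sum_filter_of_ne fun c _ hne => ?_).symm
    by_contra hc
    rw [hzero i c (by simpa using hc), zero_mul] at hne
    exact hne rfl
  · obtain ⟨Q, hQ⟩ := h.exists_mul_eq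
    refine ⟨Q.submatrix id fun a => (pivotColumn ρ a).1, ?_⟩
    conv_lhs => rw [hQ]
    rfl
  · ext a b
    rw [submatrix_apply, submatrix_apply, id, id, hrow, Matrix.one_apply]
    simp [Subtype.val_inj, eq_comm]

/-- Computes an interpolative decomposition. Elimination finds the column space, and then the pivot
rows are replaced by well-conditioned ones. -/
noncomputable def idCode (m r : ℕ) :
    Code (Fin m × Fin r) (IDData m (Operand (Fin m × Fin r))) := do
  let out ← eliminate (List.finRange m) (fun (i : Fin m) (c : Fin r) => .input (i, c))
    fun _ => none
  let res ← improveCode (pivotRow out.2) fun i a => out.1 i (pivotColumn out.2 a).1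
  pure (IDData.ofRows res.2 res.1)

theorem runs_idCode (M : Matrix (Fin m) (Fin r) ℝ) :
    Runs (fun e : Fin m × Fin r => M e.1 e.2) [] (idCode m r) (347 * (m * r ^ 2))
      (fun D mem' => IsID M
        ⟨D.k, D.l, D.σ, D.G.map (Operand.val (fun e : Fin m × Fin r => M e.1 e.2) mem')⟩) := by
  refine Runs.bind (runs_eliminate_none (K := 5 * (m * r ^ 2)) (M := M) (l := List.finRange m)
    (E := fun (i : Fin m) (c : Fin r) => .input (i, c)) (fun i c => denotes_input (i, c)) ?_)
    (N' := 342 * (m * r ^ 2)) (by linarith) ?_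
  · simp only [List.length_finRange, Fintype.card_fin]
    have : m * r ≤ m * r ^ 2 := Nat.mul_le_mul_left _ (Nat.le_self_pow two_ne_zero r)
    nlinarith
  rintro out m₁ h₁ ⟨E, hE, hred, hz, -⟩
  have hbasis := hred.isColumnBasis fun i c hc => hz i (List.mem_finRange i) c hc
  set V := E.submatrix id fun a => (pivotColumn out.2 a).1 with hVdef
  have hrank := hbasis.rank_eq
  have hkr : Fintype.card {c // (out.2 c).isSome} ≤ r := hrank ▸ M.rank_le_width
  have hkm : Fintype.card {c // (out.2 c).isSome} ≤ m := hrank ▸ M.rank_le_height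
  have hVo : DenotesMat (fun e : Fin m × Fin r => M e.1 e.2) m₁
      (fun i a => out.1 i (pivotColumn out.2 a).1) V := fun i a => hE _ _
  refine Runs.bind ((runs_improveCode hkm hVo hbasis.row).mono
    (Nat.mul_le_mul_left 342 (Nat.mul_le_mul_left m (Nat.pow_le_pow_left hkr 2))))
    (N' := 0) le_rfl ?_
  · rintro res m₂ h₂ ⟨X, hX, hint, hle⟩
    rw [IDData.ofRows, dif_pos hint.injective]
    refine Runs.pure ?_
    have := hbasis.isID (ρ := ⟨res.2, hint.injective⟩) hint hle
    convert this using 1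
    simp only [IDData.ofEmbedding]
    congr 1
    ext b a
    exact (hX _ a).val_eq

end Decomposition

end OneSided

theorem theorem3p1 :
    -- the selection schemes run within the required number of operations
    (∃ c : ℕ, ∀ (d n r p : ℕ) (π : Equiv.Perm (Fin n)), 0 < d → 0 < r → r ≤ n →
      ∃ sel : OneSided.SelProg d n r, ∀ Y : Fin n → OneSided.Pt d,
        OneSided.IsSample Y p π (sel.result Y) ∧ sel.ops Y ≤ c * (d * r ^ 2 * n)) ∧
    -- the compression algorithm, with any selection algorithm of such a cost
    (∃ idp : ∀ m r : ℕ, OneSided.IDProg m r,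
      (∀ (m r : ℕ) (M : Matrix (Fin m) (Fin r) ℝ), OneSided.IsID M ((idp m r).result M)) ∧
      ∀ c₀ a : ℕ, ∃ C : ℕ, ∀ (d m n r t : ℕ) (sel : OneSided.SelProg d n r),
        0 < d → 0 < r → t ≤ a * d →
        (∀ Y : Fin n → OneSided.Pt d, sel.ops Y ≤ c₀ * (d * r ^ 2 * n)) →
        ∀ (κ : OneSided.Pt d → OneSided.Pt d → ℝ)
          (X : Fin m → OneSided.Pt d) (Y : Fin n → OneSided.Pt d) (R : OneSided.Run m n r),
          R = OneSided.compress sel (idp m r) t κ X Y →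
          OneSided.IsID (OneSided.kernelMatrix κ X (fun b => Y (R.S b))) R.D ∧
          R.KIY = OneSided.kernelMatrix κ (fun b => X (R.D.rows b)) Y ∧
          (R.D.U * R.KIY).rank = (OneSided.kernelMatrix κ X (fun b => Y (R.S b))).rank ∧
          (R.D.U * R.KIY).rank ≤ r ∧
          R.ops ≤ C * (d * r ^ 2 * (m + n))) := by
  have hid := fun m r (M : Matrix (Fin m) (Fin r) ℝ) => OneSided.runs_idCode M
  refine ⟨OneSided.exists_sampling_program, fun m r => (OneSided.idCode m r).tree 0,
    fun m r M => (hid m r M).2.2, fun c₀ a => ⟨c₀ + 2 * a + 348, ?_⟩⟩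
  rintro d m n r t sel hd hr ht hsel κ X Y _ rfl
  set M := OneSided.kernelMatrix κ X fun b => Y (sel.result Y b) with hM
  set D := OneSided.IDProg.result ((OneSided.idCode m r).tree 0) M with hDdef
  have hD : OneSided.IsID M D := (hid m r M).2.2
  have hcost : OneSided.IDProg.ops ((OneSided.idCode m r).tree 0) M ≤ 347 * (m * r ^ 2) :=
    (hid m r M).1
  have hkr : D.k ≤ r := hD.card_rows ▸ M.rank_le_width
  have hrank : (D.U * OneSided.kernelMatrix κ (fun b => X (D.rows b)) Y).rank = M.rank := by
    refine le_antisymm ?_ ?_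
    · refine (Matrix.rank_mul_le_left _ _).trans ?_
      rw [← hD.card_rows]
      exact Matrix.rank_le_width _
    -- the columns of the approximation at the sample points are those of `M`
    · have hsub : M = (D.U * OneSided.kernelMatrix κ (fun b => X (D.rows b)) Y).submatrix id
          (sel.result Y) := by
        conv_lhs => rw [hD.factor]
        rfl
      conv_lhs => rw [hsub]
      exact Matrix.rank_submatrix_le _ _ _
  refine ⟨hD, rfl, hrank, hrank.trans_le M.rank_le_width, ?_⟩
  change sel.ops Y + t * (m * r) + OneSided.IDProg.ops ((OneSided.idCode m r).tree 0) M +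
    m * D.k + t * (D.k * n) ≤ _
  have hr₂ : r ≤ r ^ 2 := Nat.le_self_pow two_ne_zero r
  have h₁ : t * (m * r) ≤ a * d * (m * r ^ 2) :=
    Nat.mul_le_mul ht (Nat.mul_le_mul_left m hr₂)
  have h₂ : t * (D.k * n) ≤ a * d * (r ^ 2 * n) :=
    Nat.mul_le_mul ht (Nat.mul_le_mul_right n (hkr.trans hr₂))
  have h₃ : m * D.k ≤ m * r ^ 2 := Nat.mul_le_mul_left m (hkr.trans hr₂)
  have h₄ : m * r ^ 2 ≤ d * (m * r ^ 2) := Nat.le_mul_of_pos_left _ hd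
  have h₅ := hsel Y
  have h₆ : 0 ≤ c₀ * (d * r ^ 2 * m) + a * (d * r ^ 2 * m) + a * (d * r ^ 2 * n) +
    348 * (d * r ^ 2 * n) := Nat.zero_le _
  nlinarith
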